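/- **Setting.** Let $n=u+v+d\ge 1$, and let $y=(y_1,\dots,y_u)$, $z=(z_1,\dots,z_v)$, $x=(x_1,\dots,x_d)$ be disjoint groups of variables. A polynomial $f=w^TAw+2\alpha^Tw+a$ over $\mathbb R$ in the variables $w=(y,z,x)$, with $A$ symmetric, is *concave quadratic* (CQ) if $A\preceq 0$; it is stored as the symmetric $(n+1)\times(n+1)$ matrix $P$ with $f=\langle P,W\rangle$, $W=\binom{w}{1}\binom{w}{1}^T$. Consider $$\phi=\bigwedge_{i\le r_1} f_i\ge 0\wedge\bigwedge_{j\le s_1} g_j>0,\qquad \psi=\bigwedge_{r_1<i\le r} f_i\ge 0\wedge\bigwedge_{s_1<j\le s} g_j>0$$ with all $f_i=\langle P_i,W\rangle$ and $g_j=\langle Q_j,W\rangle$ CQ, those of $\phi$ in $\mathbb R[x,y]$, those of $\psi$ in $\mathbb R[x,z]$, and $\phi\wedge\psi$ unsatisfiable over $\mathbb R$. **SDP solver.** A semidefinite feasibility problem (SDP) asks for real scalars $t_i\ge 0$ and real matrices $X_b\succeq 0$ satisfying given linear equations. Its size is the number of scalar unknowns ($q^2$ for a matrix of order $q$) plus the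 number of equations. A solver returns an exact solution, or reports correctly that there is none. Its running time on an SDP is at least the number of entries of the data (every equation counts one coefficient per scalar unknown and a right-hand side), and at most $g(k)$ for every SDP of size $k$. **Algorithm IGFQC** on $(\phi,\psi)$: 1. If every variable occurring in $\phi$ occurs in $\psi$, return $\phi$. 2. With the solver, look for $\delta_i\ge0$ and $M\succeq0$ with $\sum_i\delta_iP_i+M=0$ and $\operatorname{tr}M=1$ (that is, for a nonzero sum of squares $h=\langle M,W\rangle=-\sum_i\delta_if_i$). 3. If there is none, find with the solver $\lambda_i\ge0$, $\eta_j\ge 0$ ($0\le j\le s$), and sums of squares $h_1=\langle M,W\rangle\in\mathbb R[x,y]$, $h_2=\langle \hat M,W\rangle\in\mathbb R[x,z]$ ($M,\hat M\succeq0$) with $\sum_i\lambda_if_i+\sum_{j\ge1}\eta_jg_j+\eta_0+h_1+h_2\equiv0$ and $\sum_{j\ge 0}\eta_j=1$. Put $f=\sum_{i\le r_1}\lambda_if_i+\sum_{1\le j\le s_1}\eta_jg_j+\eta_0+h_1$; return $f>0$ if $\sum_{0\le j\le s_1}\eta_j>0$, and $f\ge0$ otherwise. 4. Otherwise complete squares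 in $h$ successively in $y_1,\dots,y_u,z_1,\dots,z_v,x_1,\dots,x_d$: $h=\sum_{k=1}^n a_k(w_k-l_k)^2+c$ with $a_k,c\ge0$ and $l_k$ an affine function of later variables. Let $h_1$ be the sum of the squares belonging to $y$-variables, half of those belonging to $x$-variables, and $c/2$; let $f=\sum_{i\le r_1}\delta_if_i+h_1$. 5. If $c>0$, let $\phi'=\psi'=(0>0)$. If $c=0$, obtain $\phi',\psi'$ from $\phi,\psi$ by substituting $w_k:=l_k$ successively for all $k$ with $a_k>0$. Call IGFQC on $(\phi',\psi')$ with result $I'$, and return $(f>0)\vee(f\ge0\wedge I')$. Running time is the number of real arithmetic operations, constants, comparisons with $0$, and loop iterations, plus one step for each recursive call, plus the running time of the solver calls. Array accesses and index bookkeeping inside a loop iteration are not charged. **Theorem.** Let $D\in\mathbb R$. There is a constant $C$, depending only on $D$, such that the following holds. Let $g:\mathbb N\to\mathbb R$ be nondecreasing with $g(2k)\le D\,g(k)$ for all $k$, and let an SDP solver be given whose running time on every SDP of size $k$ is at most $g(k)$. Then, on every input as above with $n\ge1$ variables, $r$ nonstrict and $s$ strict inequalities, IGFQC terminates after at most $n$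 recursive calls, and its running time is at most $$C\cdot n\cdot g(r+s+n^2).$$ So the complexity of IGFQC is $O(n\cdot g(r+s+n^2))$. -/

import Mathlib

namespace CQInterp

/-! ## Semidefinite feasibility problems and their solvers -/

/-- One linear equation `∑ i, coef i * t i + ∑ b, ⟨mat b, X b⟩ = rhs` in `p` scalar unknowns `t`
and `B` symmetric matrix unknowns `X b` of orders `q b`. -/
structure SDPEq (V : Type) (p : ℕ) {B : ℕ} (q : Fin B → ℕ) where
  coef : Fin p → V
  mat : (b : Fin B) → Matrix (Fin (q b)) (Fin (q b)) V
  rhs : V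

/-- A semidefinite feasibility problem: find scalars `t i ≥ 0` and positive semidefinite matrices
`X b` of order `q b` that satisfy finitely many linear equations. The entries of the data lie
in `V` (the real numbers, when a program is run). -/
structure SDP (V : Type) where
  p : ℕ
  B : ℕ
  q : Fin B → ℕ
  eqs : List (SDPEq V p q)

/-- Values for the unknowns of an SDP. -/
abbrev SDP.Sol {V : Type} (I : SDP V) : Type :=
  (Fin I.p → V) × ((b : Fin I.B) → Matrix (Fin (I.q b)) (Fin (I.q b)) V)

/-- The size of an SDP: the number of its scalar unknowns (a matrix unknown of order `q` counts
`q ^ 2`) plus the number of its equations. -/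
def SDP.size {V : Type} (I : SDP V) : ℕ :=
  (I.p + ∑ b, I.q b ^ 2) + I.eqs.length

/-- The number of entries of the data of an SDP: every equation has one coefficient for each
scalar unknown, and a right-hand side. -/
def SDP.numEntries {V : Type} (I : SDP V) : ℕ :=
  I.eqs.length * (I.p + ∑ b, I.q b ^ 2 + 1)

/-- The given values solve the SDP. -/
def SDP.IsSolution (I : SDP ℝ) (w : I.Sol) : Prop :=
  (∀ i, 0 ≤ w.1 i) ∧ (∀ b, (w.2 b).PosSemidef) ∧
    ∀ e ∈ I.eqs, ∑ i, e.coef i * w.1 i + ∑ b, ∑ j, ∑ k, e.mat b j k * w.2 b j k = e.rhs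

/-- An SDP solver: it returns a solution of every solvable SDP and `none` for an unsolvable one.
It takes `time I` steps on `I`, among them at least one for each entry of the data of `I`
(it reads its input). -/
structure SDPSolver where
  solve : (I : SDP ℝ) → Option I.Sol
  time : SDP ℝ → ℕ
  sound : ∀ I w, solve I = some w → I.IsSolution w
  complete : ∀ I, solve I = none → ¬ ∃ w, I.IsSolution w
  reads : ∀ I, I.numEntries ≤ time I

/-! ## Programs over the reals with unit-cost steps and a call to an SDP solver

Programs are written for an arbitrary type `V` of values, so that values can be produced and
examined only by the instructions below. -/

/-- Programs with result type `α`: constants, arithmetic operations, tests, a bookkeeping step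
(`tick`), calls of the SDP solver, each followed by a continuation. -/
inductive Prog (V : Type) (α : Type) : Type
  | ret (a : α) : Prog V α
  | lit (c : ℚ) (k : V → Prog V α) : Prog V α
  | add (x y : V) (k : V → Prog V α) : Prog V α
  | sub (x y : V) (k : V → Prog V α) : Prog V α
  | mul (x y : V) (k : V → Prog V α) : Prog V α
  | div (x y : V) (k : V → Prog V α) : Prog V α
  | isPos (x : V) (k : Bool → Prog V α) : Prog V α
  | isZero (x : V) (k : Bool → Prog V α) : Prog V α
  | tick (k : Prog V α) : Prog V α
  | sdp (I : SDP V) (k : Option I.Sol → Prog V α) : Prog V α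

namespace Prog

variable {V α β σ : Type}

/-- Sequential composition. -/
def bind : Prog V α → (α → Prog V β) → Prog V β
  | ret a, F => F a
  | lit c k, F => lit c fun z => (k z).bind F
  | add x y k, F => add x y fun z => (k z).bind F
  | sub x y k, F => sub x y fun z => (k z).bind F
  | mul x y k, F => mul x y fun z => (k z).bind F
  | div x y k, F => div x y fun z => (k z).bind F
  | isPos x k, F => isPos x fun z => (k z).bind F
  | isZero x k, F => isZero x fun z => (k z).bind F
  | tick k, F => tick (k.bind F)
  | sdp I k, F => sdp I fun z => (k z).bind F

instance : Monad (Prog V) where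
  pure := ret
  bind := bind

open Classical in
/-- Execution over the reals with a given SDP solver: the result and the number of steps. Every
instruction takes one step, and a call of the solver takes the time of the solver. -/
noncomputable def run (S : SDPSolver) : Prog ℝ α → α × ℕ
  | ret a => (a, 0)
  | lit c k => let o := run S (k (c : ℝ)); (o.1, o.2 + 1)
  | add x y k => let o := run S (k (x + y)); (o.1, o.2 + 1)
  | sub x y k => let o := run S (k (x - y)); (o.1, o.2 + 1)
  | mul x y k => let o := run S (k (x * y)); (o.1, o.2 + 1)
  | div x y k => let o := run S (k (x / y)); (o.1, o.2 + 1)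
  | isPos x k => let o := run S (k (decide (0 < x))); (o.1, o.2 + 1)
  | isZero x k => let o := run S (k (decide (x = 0))); (o.1, o.2 + 1)
  | tick k => let o := run S k; (o.1, o.2 + 1)
  | sdp I k => let o := run S (k (S.solve I)); (o.1, o.2 + S.time I)

/-- Execute `F` for all elements of a list in turn, passing on a state. -/
def loop : List β → (β → σ → Prog V σ) → σ → Prog V σ
  | [], _, st => ret st
  | b :: L, F, st => tick ((F b st).bind fun st₁ => loop L F st₁)

/-- Execute `F` for all elements of a list in turn and collect the results. -/
def mapL : List β → (β → Prog V α) → Prog V (List α)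
  | [], _ => ret []
  | b :: L, F => tick ((F b).bind fun a => (mapL L F).bind fun l => ret (a :: l))

/-- Fill an array of length `m`. -/
def build : (m : ℕ) → (Fin m → Prog V α) → Prog V (Fin m → α)
  | 0, _ => ret Fin.elim0
  | m + 1, F =>
    tick ((F 0).bind fun a => (build m fun i => F i.succ).bind fun t =>
      ret (Fin.cons (α := fun _ => α) a t))

/-- The sum of the values `F i`, `i < m`. -/
def sum (m : ℕ) (F : Fin m → Prog V V) : Prog V V :=
  lit 0 fun z => loop (List.finRange m) (fun i acc => (F i).bind fun x => add acc x ret) z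

end Prog

/-! ## Quadratic polynomials and interpolation problems -/

/-- A quadratic polynomial `f = xᵀ A x + 2 αᵀ x + a` in `n` variables is stored as the symmetric
matrix of order `n + 1` with `f = ⟨P, (x; 1) (x; 1)ᵀ⟩`: `A` in the first `n` rows and columns,
`α` in the last row and column, and `a` in the last diagonal entry. -/
abbrev Mat (V : Type) (n : ℕ) : Type := Matrix (Fin (n + 1)) (Fin (n + 1)) V

/-- The value of the quadratic polynomial with matrix `P` at `x`. -/
def quadEval {n : ℕ} (P : Mat ℝ n) (x : Fin n → ℝ) : ℝ :=
  ∑ i, ∑ j, P i j * Fin.snoc (α := fun _ => ℝ) x 1 i * Fin.snoc (α := fun _ => ℝ) x 1 j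

/-- `P` is the matrix of a concave quadratic (CQ) polynomial: the matrix `A` of the quadratic part
is negative semidefinite. -/
def IsCQ {n : ℕ} (P : Mat ℝ n) : Prop :=
  P.IsSymm ∧ (-(P.submatrix Fin.castSucc Fin.castSucc)).PosSemidef

/-- Data of a pair of formulas in `n` variables: `φ` is the conjunction of `f i ≥ 0` for the
first `r₁` indices `i` and of `g j > 0` for the first `s₁` indices `j`, and `ψ` is the conjunction
of the inequalities for the other `r₂` indices `i` and the other `s₂` indices `j`. -/
structure Problem (V : Type) (n : ℕ) where
  r₁ : ℕ
  r₂ : ℕ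
  s₁ : ℕ
  s₂ : ℕ
  f : Fin (r₁ + r₂) → Mat V n
  g : Fin (s₁ + s₂) → Mat V n

/-- The number of nonstrict inequalities. -/
def Problem.r {V : Type} {n : ℕ} (p : Problem V n) : ℕ := p.r₁ + p.r₂

/-- The number of strict inequalities. -/
def Problem.s {V : Type} {n : ℕ} (p : Problem V n) : ℕ := p.s₁ + p.s₂

/-- The variables are ordered as `y₁, …, y_u, z₁, …, z_v, x₁, …, x_d`. This is the index of
some `y`. -/
def isY (u v d : ℕ) (i : Fin (u + v + d + 1)) : Bool := decide (i.val < u)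

/-- The index of some `z`. -/
def isZ (u v d : ℕ) (i : Fin (u + v + d + 1)) : Bool := decide (u ≤ i.val ∧ i.val < u + v)

/-- Row (and, by symmetry, column) `i` of `P` vanishes: for `i < n`, variable `i` does not occur
in the polynomial. -/
def NotIn {n : ℕ} (i : Fin (n + 1)) (P : Mat ℝ n) : Prop := ∀ j, P i j = 0

/-- The admissible inputs: CQ polynomials, those of `φ` in `ℝ[x, y]` and those of `ψ` in
`ℝ[x, z]`, such that `φ` and `ψ` are mutually contradictory. -/
structure Problem.Valid {u v d : ℕ} (p : Problem ℝ (u + v + d)) : Prop where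
  cq_f : ∀ i, IsCQ (p.f i)
  cq_g : ∀ j, IsCQ (p.g j)
  phi_f : ∀ i : Fin p.r₁, ∀ a, isZ u v d a → NotIn a (p.f (Fin.castAdd p.r₂ i))
  phi_g : ∀ j : Fin p.s₁, ∀ a, isZ u v d a → NotIn a (p.g (Fin.castAdd p.s₂ j))
  psi_f : ∀ i : Fin p.r₂, ∀ a, isY u v d a → NotIn a (p.f (Fin.natAdd p.r₁ i))
  psi_g : ∀ j : Fin p.s₂, ∀ a, isY u v d a → NotIn a (p.g (Fin.natAdd p.s₁ j))
  contradictory : ¬ ∃ x : Fin (u + v + d) → ℝ,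
    (∀ i, 0 ≤ quadEval (p.f i) x) ∧ ∀ j, 0 < quadEval (p.g j) x

/-- The formulas that serve as interpolants: `pos P` is `P > 0`, `nonneg P` is `P ≥ 0`. -/
inductive Formula (V : Type) (n : ℕ) : Type
  | top : Formula V n
  | pos (P : Mat V n) : Formula V n
  | nonneg (P : Mat V n) : Formula V n
  | and (A B : Formula V n) : Formula V n
  | or (A B : Formula V n) : Formula V n

/-! ## The algorithm -/

section Algorithm

variable {V : Type}

/-- The matrix with entry `c` where `S` holds and `0` elsewhere. -/
def indMat (m : ℕ) (c : ℚ) (S : Fin m → Fin m → Bool) : Prog V (Matrix (Fin m) (Fin m) V) :=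
  Prog.build m fun i => Prog.build m fun j =>
    if S i j then Prog.lit c Prog.ret else Prog.lit 0 Prog.ret

/-- The matrix whose only nonzero entry is a `1` at `(a, b)`. -/
def unitMat (m : ℕ) (a b : Fin m) : Prog V (Matrix (Fin m) (Fin m) V) :=
  indMat m 1 fun i j => decide (i = a ∧ j = b)

/-- The matrix `0`. -/
def zeroMat (m : ℕ) : Prog V (Matrix (Fin m) (Fin m) V) :=
  indMat m 0 fun _ _ => false

/-- All pairs of indices below `m`. -/
def pairs (m : ℕ) : List (Fin m × Fin m) := List.finRange m ×ˢ List.finRange m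

section Shape

variable {n : ℕ}

/-- Does variable `k` occur in one of the polynomials `F i`? -/
def occursIn {m : ℕ} (F : Fin m → Mat V n) (k : Fin (n + 1)) : Prog V Bool :=
  Prog.loop (List.finRange m) (fun i acc =>
    Prog.loop (List.finRange (n + 1)) (fun j acc₁ =>
      Prog.isZero (F i k j) fun z => Prog.ret (acc₁ || !z)) acc) false

/-- The test `Var(φ) ⊆ Var(ψ)`. -/
def varSubset (p : Problem V n) : Prog V Bool :=
  Prog.loop (List.finRange n) (fun k acc => do
    let a ← occursIn (fun i : Fin p.r₁ => p.f (Fin.castAdd p.r₂ i)) k.castSucc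
    let b ← occursIn (fun j : Fin p.s₁ => p.g (Fin.castAdd p.s₂ j)) k.castSucc
    let a₁ ← occursIn (fun i : Fin p.r₂ => p.f (Fin.natAdd p.r₁ i)) k.castSucc
    let b₁ ← occursIn (fun j : Fin p.s₂ => p.g (Fin.natAdd p.s₁ j)) k.castSucc
    pure (acc && (!(a || b) || (a₁ || b₁)))) true

/-- The formula `φ`. -/
def phiFormula (p : Problem V n) : Prog V (Formula V n) :=
  Prog.loop (List.finRange p.s₁)
      (fun j A => pure (Formula.and (Formula.pos (p.g (Fin.castAdd p.s₂ j))) A)) Formula.top >>=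
    Prog.loop (List.finRange p.r₁)
      (fun i A => pure (Formula.and (Formula.nonneg (p.f (Fin.castAdd p.r₂ i))) A))

/-- The equations of the SDP that decides NSOSC: find `δ i ≥ 0` and `M ⪰ 0` with
`∑ i, δ i • P i + M = 0` and `tr M = 1`. Up to a positive factor, its solutions are the `δ` for
which `h = -∑ i, δ i * f i` is a nonzero sum of squares, with `h = ⟨M, W⟩`. -/
def nsosEqs (p : Problem V n) :
    Prog V (List (SDPEq V (p.r₁ + p.r₂) (fun _ : Fin 1 => n + 1))) := do
  let E ← Prog.mapL (pairs (n + 1)) fun ab => do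
    let c ← Prog.build (p.r₁ + p.r₂) fun i => Prog.ret (p.f i ab.1 ab.2)
    let A ← Prog.build 1 fun _ => unitMat (n + 1) ab.1 ab.2
    let z ← Prog.lit 0 Prog.ret
    pure ⟨c, A, z⟩
  let c ← Prog.build (p.r₁ + p.r₂) fun _ => Prog.lit 0 Prog.ret
  let A ← Prog.build 1 fun _ => indMat (n + 1) 1 fun i j => decide (i = j)
  let o ← Prog.lit 1 Prog.ret
  pure (⟨c, A, o⟩ :: E)

/-- Decide NSOSC with the SDP solver: `none` if NSOSC holds, and otherwise `δ` and `M`. -/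
def checkNSOSC (p : Problem V n) :
    Prog V (Option ((Fin (p.r₁ + p.r₂) → V) × Mat V n)) := do
  let E ← nsosEqs p
  Prog.sdp ⟨p.r₁ + p.r₂, 1, fun _ => n + 1, E⟩ fun o =>
    Prog.ret (o.map fun w => (w.1, w.2 0))

/-- The square `a * (∑ j, c j * w j) ^ 2`, where `w = (x; 1)`, `c idx = 1`, and `c` vanishes
before `idx`. -/
structure Square (V : Type) (n : ℕ) where
  idx : Fin (n + 1)
  a : V
  c : Fin (n + 1) → V

/-- Complete squares successively in the listed variables: split the positive semidefinite
quadratic polynomial `⟨M, W⟩` into the nonzero squares that occur and a remainder without these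
variables. A variable whose diagonal entry is not positive does not occur any more, and its square
has coefficient zero. -/
def completeSquares : List (Fin (n + 1)) → Mat V n → Prog V (List (Square V n) × Mat V n)
  | [], M => Prog.ret ([], M)
  | i :: L, M => Prog.tick <| Prog.isPos (M i i) fun t =>
      if t then do
        let c ← Prog.build (n + 1) fun j => Prog.div (M i j) (M i i) Prog.ret
        let R ← Prog.build (n + 1) fun j => Prog.build (n + 1) fun k =>
          Prog.mul (c j) (M i k) fun x => Prog.sub (M j k) x Prog.ret
        let o ← completeSquares L R
        pure (⟨i, M i i, c⟩ :: o.1, o.2)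
      else completeSquares L M

/-- Replace variable `q.idx` by `-∑ j ≠ q.idx, c j * w j` in the polynomial `P`. -/
def substPoly (q : Square V n) (P : Mat V n) : Prog V (Mat V n) := do
  let e ← Prog.build (n + 1) fun j =>
    Prog.lit 0 fun z => if j = q.idx then Prog.ret z else Prog.sub z (q.c j) Prog.ret
  Prog.build (n + 1) fun j => Prog.build (n + 1) fun k =>
    if j = q.idx ∨ k = q.idx then Prog.lit 0 Prog.ret
    else
      Prog.mul (e j) (P q.idx k) fun x₁ =>
      Prog.mul (P j q.idx) (e k) fun x₂ =>
      Prog.mul (e j) (e k) fun x₃ =>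
      Prog.mul x₃ (P q.idx q.idx) fun x₄ =>
      Prog.add (P j k) x₁ fun t₁ => Prog.add t₁ x₂ fun t₂ => Prog.add t₂ x₄ Prog.ret

/-- Eliminate the variables of the given squares one after the other from all polynomials.
(For a variable that does not occur in `P`, the replacement leaves `P` unchanged; so a `z` is
replaced in `ψ` only, a `y` in `φ` only.) -/
def eliminate (L : List (Square V n)) (p : Problem V n) : Prog V (Problem V n) :=
  Prog.loop L (fun q p₁ => do
    let F ← Prog.build (p₁.r₁ + p₁.r₂) fun i => substPoly q (p₁.f i)
    let G ← Prog.build (p₁.s₁ + p₁.s₂) fun j => substPoly q (p₁.g j)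
    pure ⟨p₁.r₁, p₁.r₂, p₁.s₁, p₁.s₂, F, G⟩) p

/-- The problem `φ' = (0 > 0)`, `ψ' = (0 > 0)`. -/
def falseProblem : Prog V (Problem V n) := do
  let Z ← zeroMat (n + 1)
  pure ⟨0, 0, 1, 1, Fin.elim0, fun _ => Z⟩

end Shape

/-- Equations `X c (a, b) = 0` for the listed `(a, b)`, with two matrix unknowns `X 0`, `X 1`. -/
def vanishEqs (p m : ℕ) (c : Fin 2) (L : List (Fin m × Fin m)) :
    Prog V (List (SDPEq V p (fun _ : Fin 2 => m))) :=
  Prog.mapL L fun ab => do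
    let co ← Prog.build p fun _ => Prog.lit 0 Prog.ret
    let A ← Prog.build 2 fun b => if b = c then unitMat m ab.1 ab.2 else zeroMat m
    let z ← Prog.lit 0 Prog.ret
    pure ⟨co, A, z⟩

variable {u v d : ℕ}

/-- The equations of the SDP of IGFCH: find `λ i ≥ 0`, `η j ≥ 0` (`j = 0` included), `M ⪰ 0`
without the variables `z` and `M̂ ⪰ 0` without the variables `y`, such that
`∑ i, λ i • P i + ∑ j ≥ 1, η j • Q j + η 0 • E + M + M̂ = 0` and `∑ j, η j = 1`. The scalar
unknowns are listed as the `λ i`, then `η 0`, then the other `η j`. -/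
def igfchEqs (p : Problem V (u + v + d)) :
    Prog V (List (SDPEq V ((p.r₁ + p.r₂) + (p.s₁ + p.s₂ + 1))
      (fun _ : Fin 2 => u + v + d + 1))) := do
  let E ← Prog.mapL (pairs (u + v + d + 1)) fun ab => do
    let c ← Prog.build ((p.r₁ + p.r₂) + (p.s₁ + p.s₂ + 1)) fun i =>
      Fin.addCases (motive := fun _ => Prog V V) (fun i => Prog.ret (p.f i ab.1 ab.2))
        (fun j => Fin.cases (motive := fun _ => Prog V V)
          (if ab.1 = Fin.last _ ∧ ab.2 = Fin.last _ then Prog.lit 1 Prog.ret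
            else Prog.lit 0 Prog.ret)
          (fun j => Prog.ret (p.g j ab.1 ab.2)) j) i
    let A ← Prog.build 2 fun _ => unitMat (u + v + d + 1) ab.1 ab.2
    let z ← Prog.lit 0 Prog.ret
    pure ⟨c, A, z⟩
  let c ← Prog.build ((p.r₁ + p.r₂) + (p.s₁ + p.s₂ + 1)) fun i =>
    Fin.addCases (motive := fun _ => Prog V V) (fun _ => Prog.lit 0 Prog.ret)
      (fun _ => Prog.lit 1 Prog.ret) i
  let A ← Prog.build 2 fun _ => zeroMat (u + v + d + 1)
  let o ← Prog.lit 1 Prog.ret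
  let E₁ ← vanishEqs _ (u + v + d + 1) 0
    ((pairs (u + v + d + 1)).filter fun ab => isZ u v d ab.1 || isZ u v d ab.2)
  let E₂ ← vanishEqs _ (u + v + d + 1) 1
    ((pairs (u + v + d + 1)).filter fun ab => isY u v d ab.1 || isY u v d ab.2)
  pure (⟨c, A, o⟩ :: (E ++ (E₁ ++ E₂)))

/-- The result of IGFCH for values `w = (λ, η)` and `M` of the unknowns of its SDP: with
`f = ∑ i ≤ r₁, λ i • f i + ∑ j ≤ s₁, η j • g j + η 0 + ⟨M, W⟩`, the formula `f > 0` if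
`∑ j ≤ s₁, η j > 0` (`j = 0` included), and `f ≥ 0` otherwise. -/
def igfchResult (p : Problem V (u + v + d))
    (w : Fin ((p.r₁ + p.r₂) + (p.s₁ + p.s₂ + 1)) → V) (M : Mat V (u + v + d)) :
    Prog V (Formula V (u + v + d)) := do
  let lam : Fin p.r₁ → V := fun i => w (Fin.castAdd _ (Fin.castAdd _ i))
  let eta₀ : V := w (Fin.natAdd _ 0)
  let eta : Fin p.s₁ → V := fun j => w (Fin.natAdd _ (Fin.castAdd p.s₂ j).succ)
  let f ← Prog.build (u + v + d + 1) fun a => Prog.build (u + v + d + 1) fun b => do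
    let t₁ ← Prog.sum p.r₁ fun i => Prog.mul (lam i) (p.f (Fin.castAdd p.r₂ i) a b) Prog.ret
    let t₂ ← Prog.sum p.s₁ fun j => Prog.mul (eta j) (p.g (Fin.castAdd p.s₂ j) a b) Prog.ret
    Prog.add t₁ t₂ fun t₃ => Prog.add t₃ (M a b) fun t₄ =>
      if a = Fin.last _ ∧ b = Fin.last _ then Prog.add t₄ eta₀ Prog.ret else Prog.ret t₄
  let e ← Prog.sum p.s₁ fun j => Prog.ret (eta j)
  Prog.add e eta₀ fun e₁ => Prog.isPos e₁ fun t =>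
    Prog.ret (if t then Formula.pos f else Formula.nonneg f)

/-- Algorithm IGFCH. If its SDP has no solution (which does not happen for contradictory `φ`, `ψ`
with NSOSC), the output is arbitrary. -/
def igfch (p : Problem V (u + v + d)) : Prog V (Formula V (u + v + d)) := do
  let E ← igfchEqs p
  Prog.sdp ⟨(p.r₁ + p.r₂) + (p.s₁ + p.s₂ + 1), 2, fun _ => u + v + d + 1, E⟩ fun o =>
    match o with
    | none => Prog.ret Formula.top
    | some w => igfchResult p w.1 (w.2 0)

/-- The matrix of `h₁`, for the squares `L` and the constant `c` of `h`: the squares that belong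
to the variables `y`, half of those that belong to the variables `x`, and half of the constant. -/
def h₁Mat (L : List (Square V (u + v + d))) (c : V) : Prog V (Mat V (u + v + d)) :=
  Prog.lit (1 / 2) fun half => Prog.mul half c fun c₂ =>
  Prog.build (u + v + d + 1) fun j => Prog.build (u + v + d + 1) fun k =>
    Prog.lit 0 fun z =>
    Prog.loop L (fun q acc =>
      if isZ u v d q.idx then Prog.ret acc
      else
        Prog.mul q.a (q.c j) fun x₁ => Prog.mul x₁ (q.c k) fun x₂ =>
        if isY u v d q.idx then Prog.add acc x₂ Prog.ret
        else Prog.mul half x₂ fun x₃ => Prog.add acc x₃ Prog.ret)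
      (if j = Fin.last _ ∧ k = Fin.last _ then c₂ else z)

/-- One call of algorithm IGFQC without the recursive call: either the final result `I`, or the
polynomial `f` and the problem `(φ', ψ')` for the recursive call. -/
def igfqcCall (p : Problem V (u + v + d)) :
    Prog V (Formula V (u + v + d) ⊕ (Mat V (u + v + d) × Problem V (u + v + d))) := do
  let t ← varSubset p
  if t then
    let A ← phiFormula p
    pure (Sum.inl A)
  else
    let o ← checkNSOSC p
    match o with
    | none =>
      let A ← igfch p
      pure (Sum.inl A)
    | some (δ, M) =>
      let sq ← completeSquares ((List.finRange (u + v + d)).map Fin.castSucc) M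
      let c := sq.2 (Fin.last _) (Fin.last _)
      let H ← h₁Mat sq.1 c
      let f ← Prog.build (u + v + d + 1) fun a => Prog.build (u + v + d + 1) fun b => do
        let x ← Prog.sum p.r₁ fun i =>
          Prog.mul (δ (Fin.castAdd p.r₂ i)) (p.f (Fin.castAdd p.r₂ i) a b) Prog.ret
        Prog.add x (H a b) Prog.ret
      let t₁ ← Prog.isPos c Prog.ret
      if t₁ then
        let p₁ ← falseProblem
        pure (Sum.inr (f, p₁))
      else
        let p₁ ← eliminate sq.1 p
        pure (Sum.inr (f, p₁))

end Algorithm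

/-- `IGFQC S p I N t`: with the SDP solver `S`, algorithm IGFQC terminates on the input `p` with
the result `I` after `N` recursive calls and `t` steps, the steps of all calls included. -/
inductive IGFQC (S : SDPSolver) {u v d : ℕ} :
    Problem ℝ (u + v + d) → Formula ℝ (u + v + d) → ℕ → ℕ → Prop
  | base (p : Problem ℝ (u + v + d)) (I : Formula ℝ (u + v + d)) (t : ℕ)
      (h : (igfqcCall p).run S = (Sum.inl I, t)) : IGFQC S p I 0 t
  | recurse (p p₁ : Problem ℝ (u + v + d)) (f : Mat ℝ (u + v + d))
      (I₁ : Formula ℝ (u + v + d)) (N t t₁ : ℕ)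
      (h : (igfqcCall p).run S = (Sum.inr (f, p₁), t)) (h₁ : IGFQC S p₁ I₁ N t₁) :
      IGFQC S p (Formula.or (Formula.pos f) (Formula.and (Formula.nonneg f) I₁))
        (N + 1) (t + t₁ + 1)

end CQInterp

/-! The number of occurring variables drives the recursion. In a recursive call `M` is minus a
combination of the `P i`, so a variable absent from the problem has a zero row in `M` and hence
coefficient zero in every square; substitution therefore never introduces a variable. Each pivot has
coefficient 1 in its own square, so it did occur, and it is gone afterwards because later squares do
not contain it. Hence k squares remove at least k variables (`card_vars_eliminate`). If c is not
positive, `tr M = 1` forces k ≥ 1 (`completeSquares_ne_nil`); if c > 0, the next problem has no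
variables at all. A problem without variables is answered by the first test, so there are at most n
recursive calls.

Apart from elimination, a call costs at most two solver runs plus O(n⁴ + n²m), where m bounds the
number of inequalities (`igfqcCall_spec`). Eliminating one variable costs O(n⁴ + n²m), and at most n
variables are eliminated over the whole run, so elimination is charged to the variables and not to
the calls (`exists_IGFQC`).

Both SDPs have size O(r + s + n²), so doubling g a fixed number of times bounds their time. Since a
solver reads its input, g(k) ≥ k²/4 (`sq_le_four_mul_time`), and with k = r + s + n² this absorbs
the polynomial overhead (`overhead_le`). -/

namespace CQInterp

/-! ### Results and step counts of programs -/

namespace Prog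

variable {V α β σ : Type} (S : SDPSolver)

/-- The result of a program. -/
noncomputable def val (x : Prog ℝ α) : α := (x.run S).1

/-- The number of steps of a program. -/
noncomputable def cost (x : Prog ℝ α) : ℕ := (x.run S).2

theorem run_eq (x : Prog ℝ α) : x.run S = (x.val S, x.cost S) := rfl

theorem bind_eq (x : Prog V α) (F : α → Prog V β) : x >>= F = x.bind F := rfl

theorem pure_eq (a : α) : (pure a : Prog V α) = ret a := rfl

/-- Every instruction adds its own charge to that of its continuation, so step counts add under
composition. All cost bounds below rest on this. -/
theorem run_bind (x : Prog ℝ α) (F : α → Prog ℝ β) :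
    (x.bind F).run S = ((F (x.val S)).val S, x.cost S + (F (x.val S)).cost S) := by
  induction x with
  | ret a => simp [bind, val, cost, run]
  | isPos x k ih | isZero x k ih =>
    simp only [bind, val, cost, run] at ih ⊢
    rw [ih]
    simp [Nat.add_right_comm]
  | _ => simp_all [bind, val, cost, run, Nat.add_right_comm]

@[simp] theorem val_bind (x : Prog ℝ α) (F : α → Prog ℝ β) :
    (x.bind F).val S = (F (x.val S)).val S := by
  rw [val, run_bind]

@[simp] theorem cost_bind (x : Prog ℝ α) (F : α → Prog ℝ β) :
    (x.bind F).cost S = x.cost S + (F (x.val S)).cost S := by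
  rw [cost, run_bind]

@[simp] theorem val_ret (a : α) : (ret a : Prog ℝ α).val S = a := rfl
@[simp] theorem cost_ret (a : α) : (ret a : Prog ℝ α).cost S = 0 := rfl
@[simp] theorem val_lit (c : ℚ) (k : ℝ → Prog ℝ α) : (lit c k).val S = (k c).val S := rfl
@[simp] theorem cost_lit (c : ℚ) (k : ℝ → Prog ℝ α) :
    (lit c k).cost S = (k c).cost S + 1 := rfl
@[simp] theorem val_add (x y : ℝ) (k : ℝ → Prog ℝ α) :
    (add x y k).val S = (k (x + y)).val S := rfl
@[simp] theorem cost_add (x y : ℝ) (k : ℝ → Prog ℝ α) :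
    (add x y k).cost S = (k (x + y)).cost S + 1 := rfl
@[simp] theorem val_sub (x y : ℝ) (k : ℝ → Prog ℝ α) :
    (sub x y k).val S = (k (x - y)).val S := rfl
@[simp] theorem cost_sub (x y : ℝ) (k : ℝ → Prog ℝ α) :
    (sub x y k).cost S = (k (x - y)).cost S + 1 := rfl
@[simp] theorem val_mul (x y : ℝ) (k : ℝ → Prog ℝ α) :
    (mul x y k).val S = (k (x * y)).val S := rfl
@[simp] theorem cost_mul (x y : ℝ) (k : ℝ → Prog ℝ α) :
    (mul x y k).cost S = (k (x * y)).cost S + 1 := rfl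
@[simp] theorem val_div (x y : ℝ) (k : ℝ → Prog ℝ α) :
    (div x y k).val S = (k (x / y)).val S := rfl
@[simp] theorem cost_div (x y : ℝ) (k : ℝ → Prog ℝ α) :
    (div x y k).cost S = (k (x / y)).cost S + 1 := rfl
open Classical in
@[simp] theorem val_isPos (x : ℝ) (k : Bool → Prog ℝ α) :
    (isPos x k).val S = (k (decide (0 < x))).val S := rfl
open Classical in
@[simp] theorem cost_isPos (x : ℝ) (k : Bool → Prog ℝ α) :
    (isPos x k).cost S = (k (decide (0 < x))).cost S + 1 := rfl
open Classical in
@[simp] theorem val_isZero (x : ℝ) (k : Bool → Prog ℝ α) :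
    (isZero x k).val S = (k (decide (x = 0))).val S := rfl
open Classical in
@[simp] theorem cost_isZero (x : ℝ) (k : Bool → Prog ℝ α) :
    (isZero x k).cost S = (k (decide (x = 0))).cost S + 1 := rfl
@[simp] theorem val_tick (k : Prog ℝ α) : (tick k).val S = k.val S := rfl
@[simp] theorem cost_tick (k : Prog ℝ α) : (tick k).cost S = k.cost S + 1 := rfl
@[simp] theorem val_sdp (I : SDP ℝ) (k : Option I.Sol → Prog ℝ α) :
    (sdp I k).val S = (k (S.solve I)).val S := rfl
@[simp] theorem cost_sdp (I : SDP ℝ) (k : Option I.Sol → Prog ℝ α) :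
    (sdp I k).cost S = (k (S.solve I)).cost S + S.time I := rfl

theorem val_loop (L : List β) (F : β → σ → Prog ℝ σ) (st : σ) :
    (loop L F st).val S = L.foldl (fun a b => (F b a).val S) st := by
  induction L generalizing st with
  | nil => rfl
  | cons b L ih => simp [loop, ih]

/-- The `+ 1` is the tick of an iteration. The bound `c` must hold for all states, so the evolution
of the state need not be followed. -/
theorem cost_loop_le {L : List β} {F : β → σ → Prog ℝ σ} {l c : ℕ} (hl : L.length ≤ l)
    (hF : ∀ b st, (F b st).cost S ≤ c) (st : σ) : (loop L F st).cost S ≤ l * (c + 1) := by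
  refine le_trans ?_ (Nat.mul_le_mul_right _ hl)
  clear hl
  induction L generalizing st with
  | nil => simp [loop]
  | cons b L ih =>
    have h₁ := hF b st
    have h₂ := ih ((F b st).val S)
    simp only [loop, cost_tick, cost_bind, List.length_cons, add_mul, one_mul]
    simp only [mul_add, mul_one] at h₂ ⊢
    omega

@[simp] theorem val_mapL (L : List β) (F : β → Prog ℝ α) :
    (mapL L F).val S = L.map fun b => (F b).val S := by
  induction L with
  | nil => rfl
  | cons b L ih => simp [mapL, ih]

theorem cost_mapL_le {L : List β} {F : β → Prog ℝ α} {l c : ℕ} (hl : L.length ≤ l)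
    (hF : ∀ b, (F b).cost S ≤ c) : (mapL L F).cost S ≤ l * (c + 1) := by
  refine le_trans ?_ (Nat.mul_le_mul_right _ hl)
  clear hl
  induction L with
  | nil => simp [mapL]
  | cons b L ih =>
    have h₁ := hF b
    simp only [mapL, cost_tick, cost_bind, cost_ret, List.length_cons]
    simp only [add_mul, mul_add, one_mul, mul_one] at ih ⊢
    omega

@[simp] theorem val_build (m : ℕ) (F : Fin m → Prog ℝ α) :
    (build m F).val S = fun i => (F i).val S := by
  induction m with
  | zero => funext i; exact i.elim0
  | succ m ih =>
    funext i
    simp only [build, val_tick, val_bind, val_ret, ih]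
    cases i using Fin.cases <;> simp

theorem val_build_build (m k : ℕ) (F : Fin m → Fin k → Prog ℝ α) (i : Fin m) (j : Fin k) :
    (build m fun i => build k fun j => F i j).val S i j = (F i j).val S := by
  simp

theorem cost_build_le {m l c : ℕ} {F : Fin m → Prog ℝ α} (hl : m ≤ l)
    (hF : ∀ i, (F i).cost S ≤ c) : (build m F).cost S ≤ l * (c + 1) := by
  refine le_trans ?_ (Nat.mul_le_mul_right _ hl)
  clear hl
  induction m with
  | zero => simp [build]
  | succ m ih =>
    have h₁ := hF 0
    have h₂ := ih fun i => hF i.succ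
    simp only [build, cost_tick, cost_bind, cost_ret]
    simp only [add_mul, mul_add, one_mul, mul_one] at h₂ ⊢
    omega

/-- Each summand pays for one addition and one tick; the final `+ 1` is the initial constant. -/
theorem cost_sum_le {m l c : ℕ} {F : Fin m → Prog ℝ ℝ} (hl : m ≤ l)
    (hF : ∀ i, (F i).cost S ≤ c) : (sum m F).cost S ≤ l * (c + 2) + 1 := by
  have h := cost_loop_le S (L := List.finRange m) (c := c + 1)
    (F := fun i acc => (F i).bind fun x => add acc x ret) (by simpa using hl)
    (by intro i st; simpa using hF i) ((0 : ℚ) : ℝ)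
  simpa [sum] using h

end Prog

/-! ### Constant matrices and index pairs -/

open Prog

variable (S : SDPSolver)

theorem val_indMat (m : ℕ) (c : ℚ) (A : Fin m → Fin m → Bool) :
    (indMat m c A : Prog ℝ _).val S = fun i j => if A i j then (c : ℝ) else 0 := by
  funext i j
  refine (val_build_build S m m _ i j).trans ?_
  split <;> simp

theorem cost_indMat_le (m : ℕ) (c : ℚ) (A : Fin m → Fin m → Bool) :
    (indMat m c A : Prog ℝ _).cost S ≤ m * (m * 2 + 1) :=
  cost_build_le S le_rfl fun i => cost_build_le S le_rfl fun j => by split <;> simp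

theorem val_unitMat (m : ℕ) (a b : Fin m) :
    (unitMat m a b : Prog ℝ _).val S = fun i j => if i = a ∧ j = b then 1 else 0 := by
  funext i j
  simp [unitMat, val_indMat]

theorem cost_unitMat_le (m : ℕ) (a b : Fin m) :
    (unitMat m a b : Prog ℝ _).cost S ≤ m * (m * 2 + 1) :=
  cost_indMat_le S _ _ _

theorem val_zeroMat (m : ℕ) : (zeroMat m : Prog ℝ _).val S = 0 := by
  simp only [zeroMat, val_indMat]
  funext i j
  simp

theorem cost_zeroMat_le (m : ℕ) : (zeroMat m : Prog ℝ _).cost S ≤ m * (m * 2 + 1) :=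
  cost_indMat_le S _ _ _

theorem length_pairs (m : ℕ) : (pairs m).length = m * m := by
  simp only [pairs, List.length_product, List.length_finRange]

theorem mem_pairs {m : ℕ} (ab : Fin m × Fin m) : ab ∈ pairs m := by
  obtain ⟨a, b⟩ := ab
  simp [pairs]

/-! ### Occurrence of variables and the SDP for NSOSC -/

section Shape

variable {n : ℕ}

theorem val_occursIn_of_notIn {m : ℕ} {F : Fin m → Mat ℝ n} {k : Fin (n + 1)}
    (h : ∀ i, NotIn k (F i)) : (occursIn F k).val S = false := by
  have h₁ : ∀ (i : Fin m) (L : List (Fin (n + 1))) (acc : Bool),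
      (loop L (fun j acc₁ => isZero (F i k j) fun z => ret (acc₁ || !z)) acc).val S = acc := by
    intro i L acc
    induction L generalizing acc with
    | nil => rfl
    | cons j L ih => simp [loop, h i j, ih]
  rw [occursIn, val_loop]
  simp only [h₁]
  induction List.finRange m with
  | nil => rfl
  | cons i L ih => simp

theorem cost_occursIn_le {m l : ℕ} (hl : m ≤ l) (F : Fin m → Mat ℝ n) (k : Fin (n + 1)) :
    (occursIn F k).cost S ≤ l * ((n + 1) * 2 + 1) :=
  cost_loop_le S (by simpa using hl)
    (fun i st => cost_loop_le S (by simp) (fun j st₁ => by simp) st) _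

/-- Variable `k` occurs in none of the polynomials of the problem. -/
def Problem.Absent (p : Problem ℝ n) (k : Fin (n + 1)) : Prop :=
  (∀ i, NotIn k (p.f i)) ∧ ∀ j, NotIn k (p.g j)

/-- The end of the recursion: with no variable left, every implication tested is vacuous, so the
call returns φ. -/
theorem val_varSubset_of_absent {p : Problem ℝ n} (h : ∀ k : Fin n, p.Absent k.castSucc) :
    (varSubset p).val S = true := by
  rw [varSubset, val_loop]
  simp only [bind_eq, pure_eq, val_bind, val_ret]
  induction List.finRange n with
  | nil => rfl
  | cons k L ih =>
    rw [List.foldl_cons,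
      val_occursIn_of_notIn S (F := fun i : Fin p.r₁ => p.f (Fin.castAdd p.r₂ i))
        fun i => (h k).1 _,
      val_occursIn_of_notIn S (F := fun i : Fin p.s₁ => p.g (Fin.castAdd p.s₂ i))
        fun i => (h k).2 _]
    exact ih

theorem cost_varSubset_le {m : ℕ} {p : Problem ℝ n} (hp : p.r + p.s ≤ m) :
    (varSubset p).cost S ≤ n * (4 * (m * ((n + 1) * 2 + 1)) + 1) := by
  simp only [Problem.r, Problem.s] at hp
  refine cost_loop_le S (by simp) (fun k st => ?_) _
  simp only [bind_eq, pure_eq, cost_bind, cost_ret]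
  have h₁ := cost_occursIn_le S (show p.r₁ ≤ m by omega)
    (fun i => p.f (Fin.castAdd p.r₂ i)) k.castSucc
  have h₂ := cost_occursIn_le S (show p.r₂ ≤ m by omega)
    (fun i => p.f (Fin.natAdd p.r₁ i)) k.castSucc
  have h₃ := cost_occursIn_le S (show p.s₁ ≤ m by omega)
    (fun i => p.g (Fin.castAdd p.s₂ i)) k.castSucc
  have h₄ := cost_occursIn_le S (show p.s₂ ≤ m by omega)
    (fun i => p.g (Fin.natAdd p.s₁ i)) k.castSucc
  omega

theorem cost_phiFormula_le {m : ℕ} {p : Problem ℝ n} (hp : p.r + p.s ≤ m) :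
    (phiFormula p).cost S ≤ m + m := by
  simp only [Problem.r, Problem.s] at hp
  simp only [phiFormula, bind_eq, cost_bind]
  refine add_le_add ?_ ?_
  · exact (cost_loop_le S (l := m) (c := 0) (by simp; omega) (fun _ _ => by simp [pure_eq]) _).trans
      (by simp)
  · exact (cost_loop_le S (l := m) (c := 0) (by simp; omega) (fun _ _ => by simp [pure_eq]) _).trans
      (by simp)

theorem cost_nsosEqs_le {m : ℕ} {p : Problem ℝ n} (hp : p.r + p.s ≤ m) :
    (nsosEqs p).cost S ≤ (n + 1) * (n + 1) *
        (m * (0 + 1) + (1 * ((n + 1) * ((n + 1) * 2 + 1) + 1) + 1) + 1) +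
      (m * (1 + 1) + (1 * ((n + 1) * ((n + 1) * 2 + 1) + 1) + 1)) := by
  simp only [Problem.r, Problem.s] at hp
  simp only [nsosEqs, bind_eq, pure_eq, cost_bind, cost_ret, cost_lit, zero_add, add_zero]
  refine add_le_add (cost_mapL_le S (length_pairs _).le fun ab => ?_) (add_le_add ?_ ?_)
  · simp only [cost_bind, cost_ret, cost_lit, zero_add]
    refine add_le_add ?_ (Nat.add_le_add_right ?_ 1)
    · exact cost_build_le S (by omega) fun i => by simp
    · exact cost_build_le S (by omega) fun i => cost_unitMat_le S _ _ _
  · exact cost_build_le S (by omega) fun i => by simp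
  · refine Nat.add_le_add_right ?_ 1
    exact cost_build_le S (by omega) fun i => cost_indMat_le S _ _ _

theorem length_nsosEqs (p : Problem ℝ n) :
    ((nsosEqs p).val S).length = (n + 1) * (n + 1) + 1 := by
  simp [nsosEqs, bind_eq, pure_eq, length_pairs]

/-- The meaning of the solutions that `checkNSOSC` returns. -/
theorem val_checkNSOSC {p : Problem ℝ n} {δ : Fin (p.r₁ + p.r₂) → ℝ} {M : Mat ℝ n}
    (h : (checkNSOSC p).val S = some (δ, M)) :
    M.PosSemidef ∧ (∑ i, M i i = 1) ∧ ∀ a b, ∑ i, p.f i a b * δ i + M a b = 0 := by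
  simp only [checkNSOSC, bind_eq, val_bind, val_sdp, val_ret, Option.map_eq_some_iff] at h
  obtain ⟨w, hw, hδ⟩ := h
  obtain ⟨-, h₂, h₃⟩ := S.sound _ _ hw
  simp only [Prod.mk.injEq] at hδ
  obtain ⟨rfl, rfl⟩ := hδ
  refine ⟨h₂ 0, ?_, fun a b => ?_⟩
  -- The normalising equation, whose coefficient matrix is the identity, gives the trace.
  · have := h₃ ⟨fun _ => 0, fun _ i j => if i = j then 1 else 0, 1⟩
      (by simp [nsosEqs, bind_eq, pure_eq, val_indMat])
    simpa using this
  -- The equation of the pair (a, b) has a matrix unit as coefficient, which picks out one entry of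
  -- `M`.
  · have := h₃ ⟨fun i => p.f i a b, fun _ i j => if i = a ∧ j = b then 1 else 0, 0⟩ (by
      simp only [nsosEqs, bind_eq, pure_eq, val_bind, val_mapL, val_ret, List.mem_cons,
        List.mem_map]
      exact Or.inr ⟨(a, b), mem_pairs _, by simp [val_unitMat]⟩)
    simpa [ite_and] using this

theorem cost_checkNSOSC_le {m l T : ℕ} {p : Problem ℝ n} (hp : p.r + p.s ≤ m)
    (hT : ∀ I : SDP ℝ, I.size ≤ l → S.time I ≤ T)
    (hl : m + (n + 1) ^ 2 + ((n + 1) * (n + 1) + 1) ≤ l) :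
    (checkNSOSC p).cost S ≤ (nsosEqs p).cost S + T := by
  simp only [checkNSOSC, bind_eq, cost_bind, cost_sdp, cost_ret, zero_add]
  refine Nat.add_le_add_left (hT _ (le_trans ?_ hl)) _
  simp only [Problem.r, Problem.s] at hp
  simp only [SDP.size, length_nsosEqs]
  simp
  omega

end Shape

/-! ### Completing squares -/

section Shape

variable {n : ℕ}

/-- What remains of the quadratic form `M` after completing the square in variable `i`. -/
noncomputable def pivotRemainder (M : Mat ℝ n) (i : Fin (n + 1)) : Mat ℝ n :=
  Matrix.of fun j k => M j k - M i j / M i i * M i k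

theorem pivotRemainder_apply (M : Mat ℝ n) (i j k : Fin (n + 1)) :
    pivotRemainder M i j k = M j k - M i j / M i i * M i k := rfl

theorem completeSquares_cons_of_pos {M : Mat ℝ n} {i : Fin (n + 1)} (L : List (Fin (n + 1)))
    (h : 0 < M i i) :
    (completeSquares (i :: L) M).val S =
      (⟨i, M i i, fun j => M i j / M i i⟩ ::
        ((completeSquares L (pivotRemainder M i)).val S).1,
        ((completeSquares L (pivotRemainder M i)).val S).2) := by
  simp only [completeSquares, bind_eq, pure_eq, val_tick, val_isPos, h, decide_true, if_true,
    val_bind, val_build, val_div, val_ret]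
  rfl

theorem completeSquares_cons_of_not_pos {M : Mat ℝ n} {i : Fin (n + 1)}
    (L : List (Fin (n + 1))) (h : ¬ 0 < M i i) :
    (completeSquares (i :: L) M).val S = (completeSquares L M).val S := by
  simp [completeSquares, h]

theorem cost_completeSquares_le (L : List (Fin (n + 1))) (M : Mat ℝ n) :
    (completeSquares L M).cost S ≤
      L.length * ((n + 1) * (1 + 1) + (n + 1) * ((n + 1) * (2 + 1) + 1) + 2) := by
  induction L generalizing M with
  | nil => simp [completeSquares]
  | cons i L ih =>
    simp only [completeSquares, cost_tick, cost_isPos, List.length_cons]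
    rw [Nat.add_mul, one_mul]
    split
    · simp only [bind_eq, pure_eq, cost_bind, cost_ret, add_zero]
      have h₁ := cost_build_le S (c := 1) (F := fun j => div (M i j) (M i i) ret)
        (le_refl (n + 1)) (by intro j; simp)
      have h₂ := fun c : Fin (n + 1) → ℝ => cost_build_le S (c := (n + 1) * (2 + 1))
        (F := fun j => build (n + 1) fun k => mul (c j) (M i k) fun x => sub (M j k) x ret)
        (le_refl (n + 1)) (fun j => cost_build_le S le_rfl fun k => by simp)
      exact (add_le_add_left (add_le_add_left
        (add_le_add h₁ (add_le_add (h₂ _) (ih _))) 1) 1).trans (by omega)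
    · exact (add_le_add_left (add_le_add_left (ih _) 1) 1).trans (by omega)

theorem pivotRemainder_isSymm {M : Mat ℝ n} (hM : M.IsSymm) (i : Fin (n + 1)) :
    (pivotRemainder M i).IsSymm := by
  refine Matrix.IsSymm.ext fun j k => ?_
  rw [pivotRemainder_apply, pivotRemainder_apply, hM.apply j k]
  ring

/-- By symmetry a zero row gives `M i j = 0`, so the rank-one correction vanishes on that row as
well. -/
theorem notIn_pivotRemainder {M : Mat ℝ n} (hM : M.IsSymm) {i j : Fin (n + 1)}
    (h : NotIn j M) : NotIn j (pivotRemainder M i) := by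
  intro k
  rw [pivotRemainder_apply, h k, ← hM.apply, h i]
  simp

theorem notIn_pivotRemainder_self {M : Mat ℝ n} {i : Fin (n + 1)} (h : 0 < M i i) :
    NotIn i (pivotRemainder M i) := by
  intro k
  rw [pivotRemainder_apply, div_self h.ne']
  simp

/-- A zero row survives every pivot step, and each recorded coefficient is a quotient of an entry of
that row. This serves both for variables absent from the start and for earlier pivots. -/
theorem coeff_completeSquares_eq_zero {L : List (Fin (n + 1))} {M : Mat ℝ n} (hM : M.IsSymm)
    {j : Fin (n + 1)} (h : NotIn j M) :
    ∀ q ∈ ((completeSquares L M).val S).1, q.c j = 0 := by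
  induction L generalizing M with
  | nil => simp [completeSquares]
  | cons i L ih =>
    by_cases hi : 0 < M i i
    · rw [completeSquares_cons_of_pos S L hi]
      intro q hq
      rcases List.mem_cons.1 hq with rfl | hq
      · show M i j / M i i = 0
        rw [← hM.apply, h i, zero_div]
      · exact ih (pivotRemainder_isSymm hM i) (notIn_pivotRemainder hM h) q hq
    · rw [completeSquares_cons_of_not_pos S L hi]
      exact ih hM h

theorem coeff_completeSquares_idx {L : List (Fin (n + 1))} {M : Mat ℝ n} :
    ∀ q ∈ ((completeSquares L M).val S).1, q.c q.idx = 1 := by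
  induction L generalizing M with
  | nil => simp [completeSquares]
  | cons i L ih =>
    by_cases hi : 0 < M i i
    · rw [completeSquares_cons_of_pos S L hi]
      intro q hq
      rcases List.mem_cons.1 hq with rfl | hq
      · exact div_self hi.ne'
      · exact ih q hq
    · rw [completeSquares_cons_of_not_pos S L hi]
      exact ih

/-- A pivot clears its own row in the remainder. Consequently later substitutions cannot bring an
eliminated variable back. -/
theorem pairwise_completeSquares {L : List (Fin (n + 1))} {M : Mat ℝ n} (hM : M.IsSymm) :
    ((completeSquares L M).val S).1.Pairwise fun q q' => q'.c q.idx = 0 := by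
  induction L generalizing M with
  | nil => simp [completeSquares]
  | cons i L ih =>
    by_cases hi : 0 < M i i
    · rw [completeSquares_cons_of_pos S L hi]
      exact List.pairwise_cons.2 ⟨coeff_completeSquares_eq_zero S (pivotRemainder_isSymm hM i)
        (notIn_pivotRemainder_self hi), ih (pivotRemainder_isSymm hM i)⟩
    · rw [completeSquares_cons_of_not_pos S L hi]
      exact ih hM

/-- A sublist, rather than a subset, because this yields both distinct pivots and a bound on their
number. -/
theorem idx_completeSquares_sublist (L : List (Fin (n + 1))) (M : Mat ℝ n) :
    (((completeSquares L M).val S).1.map Square.idx).Sublist L := by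
  induction L generalizing M with
  | nil => simp [completeSquares]
  | cons i L ih =>
    by_cases hi : 0 < M i i
    · rw [completeSquares_cons_of_pos S L hi]
      exact (ih _).cons_cons i
    · rw [completeSquares_cons_of_not_pos S L hi]
      exact (ih _).cons i

/-- Without a square no pivot step was made, so every diagonal test was performed on the original
matrix and failed. -/
theorem completeSquares_eq_nil {L : List (Fin (n + 1))} {M : Mat ℝ n}
    (h : ((completeSquares L M).val S).1 = []) :
    ((completeSquares L M).val S).2 = M ∧ ∀ i ∈ L, M i i ≤ 0 := by
  induction L generalizing M with
  | nil => simp [completeSquares]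
  | cons i L ih =>
    by_cases hi : 0 < M i i
    · rw [completeSquares_cons_of_pos S L hi] at h
      simp at h
    · rw [completeSquares_cons_of_not_pos S L hi] at h ⊢
      exact ⟨(ih h).1, List.forall_mem_cons.2 ⟨not_lt.1 hi, (ih h).2⟩⟩

/-! ### Substitution and elimination of variables -/

theorem val_substPoly (q : Square ℝ n) (P : Mat ℝ n) (j k : Fin (n + 1)) :
    (substPoly q P).val S j k =
      if j = q.idx ∨ k = q.idx then 0
      else P j k + (if j = q.idx then 0 else 0 - q.c j) * P q.idx k +
        P j q.idx * (if k = q.idx then 0 else 0 - q.c k) +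
        (if j = q.idx then 0 else 0 - q.c j) * (if k = q.idx then 0 else 0 - q.c k) *
          P q.idx q.idx := by
  refine (congrFun (congrFun (val_bind S _ _) j) k).trans ((val_build_build S _ _ _ j k).trans ?_)
  rw [val_build]
  split_ifs <;> simp_all

theorem notIn_substPoly_idx (q : Square ℝ n) (P : Mat ℝ n) :
    NotIn q.idx ((substPoly q P).val S) := by
  intro k
  simp [val_substPoly]

/-- Each term of the new row contains an entry of row `j` of `P` or the factor `q.c j`. -/
theorem notIn_substPoly {q : Square ℝ n} {P : Mat ℝ n} {j : Fin (n + 1)} (h : NotIn j P)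
    (hq : q.c j = 0) : NotIn j ((substPoly q P).val S) := by
  intro k
  simp [val_substPoly, h k, h q.idx, hq]

theorem cost_substPoly_le (q : Square ℝ n) (P : Mat ℝ n) :
    (substPoly q P).cost S ≤ (n + 1) * (2 + 1) + (n + 1) * ((n + 1) * (7 + 1) + 1) := by
  refine (cost_bind S _ _).le.trans (add_le_add (cost_build_le S le_rfl fun j => ?_)
    (cost_build_le S le_rfl fun j => cost_build_le S le_rfl fun k => ?_))
  · simp only [cost_lit]
    split <;> simp
  · split <;> simp

/-- The problem with variable `q.idx` eliminated. -/
noncomputable def substProblem (q : Square ℝ n) (p : Problem ℝ n) : Problem ℝ n :=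
  ⟨p.r₁, p.r₂, p.s₁, p.s₂, fun i => (substPoly q (p.f i)).val S,
    fun j => (substPoly q (p.g j)).val S⟩

theorem val_eliminate_cons (q : Square ℝ n) (L : List (Square ℝ n)) (p : Problem ℝ n) :
    (eliminate (q :: L) p).val S = (eliminate L (substProblem S q p)).val S := by
  simp [eliminate, loop, bind_eq, pure_eq, substProblem]

/-- Proportional to the number of squares; this is what allows elimination to be charged per removed
variable. -/
theorem cost_eliminate_le {m : ℕ} (L : List (Square ℝ n)) {p : Problem ℝ n}
    (hp : p.r + p.s ≤ m) :
    (eliminate L p).cost S ≤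
      L.length * (2 * (m * ((n + 1) * (2 + 1) + (n + 1) * ((n + 1) * (7 + 1) + 1) + 1)) + 1) := by
  induction L generalizing p with
  | nil => simp [eliminate, loop]
  | cons q L ih =>
    have h := ih (p := substProblem S q p) hp
    simp only [Problem.r, Problem.s] at hp
    have h₁ := cost_build_le S (show p.r₁ + p.r₂ ≤ m by omega)
      fun i => cost_substPoly_le S q (p.f i)
    have h₂ := cost_build_le S (show p.s₁ + p.s₂ ≤ m by omega)
      fun i => cost_substPoly_le S q (p.g i)
    have h₃ : (eliminate (q :: L) p).cost S =
        (build (p.r₁ + p.r₂) fun i => substPoly q (p.f i)).cost S +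
        (build (p.s₁ + p.s₂) fun i => substPoly q (p.g i)).cost S +
        (eliminate L (substProblem S q p)).cost S + 1 := by
      simp [eliminate, loop, bind_eq, pure_eq, substProblem]
    rw [h₃, List.length_cons, Nat.add_mul, one_mul]
    omega

theorem size_eliminate (L : List (Square ℝ n)) (p : Problem ℝ n) :
    ((eliminate L p).val S).r + ((eliminate L p).val S).s = p.r + p.s := by
  induction L generalizing p with
  | nil => simp [eliminate, loop]
  | cons q L ih => rw [val_eliminate_cons, ih]; rfl

theorem absent_substProblem {q : Square ℝ n} {p : Problem ℝ n} {j : Fin (n + 1)}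
    (h : p.Absent j) (hq : q.c j = 0) : (substProblem S q p).Absent j :=
  ⟨fun i => notIn_substPoly S (h.1 i) hq, fun i => notIn_substPoly S (h.2 i) hq⟩

theorem absent_substProblem_idx (q : Square ℝ n) (p : Problem ℝ n) :
    (substProblem S q p).Absent q.idx :=
  ⟨fun _ => notIn_substPoly_idx S _ _, fun _ => notIn_substPoly_idx S _ _⟩

theorem absent_eliminate {L : List (Square ℝ n)} {p : Problem ℝ n} {j : Fin (n + 1)}
    (h : p.Absent j) (hL : ∀ q ∈ L, q.c j = 0) : ((eliminate L p).val S).Absent j := by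
  induction L generalizing p with
  | nil => simpa [eliminate, loop] using h
  | cons q L ih =>
    rw [val_eliminate_cons]
    rw [List.forall_mem_cons] at hL
    exact ih (absent_substProblem S h hL.1) hL.2

/-- Each pivot disappears when its own square is processed, and stays away because its coefficient
in all later squares is zero. -/
theorem absent_eliminate_idx {L : List (Square ℝ n)} (p : Problem ℝ n)
    (hL : L.Pairwise fun q q' => q'.c q.idx = 0) :
    ∀ q ∈ L, ((eliminate L p).val S).Absent q.idx := by
  induction L generalizing p with
  | nil => simp
  | cons q L ih =>
    rw [val_eliminate_cons, List.forall_mem_cons]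
    rw [List.pairwise_cons] at hL
    exact ⟨absent_eliminate S (absent_substProblem_idx S q p) hL.1, ih _ hL.2⟩

theorem val_falseProblem : (falseProblem : Prog ℝ (Problem ℝ n)).val S =
    ⟨0, 0, 1, 1, Fin.elim0, fun _ => 0⟩ := by
  simp only [falseProblem, bind_eq, pure_eq, val_bind, val_ret]
  rw [val_zeroMat]

theorem absent_falseProblem (j : Fin (n + 1)) :
    ((falseProblem : Prog ℝ (Problem ℝ n)).val S).Absent j := by
  rw [val_falseProblem]
  exact ⟨fun i => i.elim0, fun _ _ => rfl⟩

theorem size_falseProblem :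
    ((falseProblem : Prog ℝ (Problem ℝ n)).val S).r +
      ((falseProblem : Prog ℝ (Problem ℝ n)).val S).s = 2 := by
  rw [val_falseProblem]
  rfl

theorem cost_falseProblem_le :
    (falseProblem : Prog ℝ (Problem ℝ n)).cost S ≤ (n + 1) * ((n + 1) * 2 + 1) :=
  (cost_bind S _ _).le.trans (cost_zeroMat_le S (n + 1))

end Shape

/-! ### Cost of IGFCH and of the matrix of h₁ -/

theorem cost_vanishEqs_le (k m : ℕ) (c : Fin 2) (L : List (Fin m × Fin m)) {K : ℕ} (hK : k ≤ K)
    (hL : L.length ≤ m * m) :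
    (vanishEqs k m c L : Prog ℝ _).cost S ≤
      m * m * (K * (1 + 1) + (2 * (m * (m * 2 + 1) + 1) + 1) + 1) := by
  refine cost_mapL_le S hL fun ab => ?_
  simp only [bind_eq, pure_eq, cost_bind, cost_ret, cost_lit, zero_add]
  refine add_le_add (cost_build_le S hK fun i => by simp)
    (Nat.add_le_add_right (cost_build_le S le_rfl fun i => ?_) 1)
  split
  · exact cost_unitMat_le S _ _ _
  · exact cost_zeroMat_le S _

theorem length_vanishEqs (k m : ℕ) (c : Fin 2) (L : List (Fin m × Fin m)) :
    ((vanishEqs k m c L : Prog ℝ _).val S).length = L.length := by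
  simp [vanishEqs]

variable {u v d : ℕ}

theorem cost_igfchEqs_le {m : ℕ} {p : Problem ℝ (u + v + d)} (hp : p.r + p.s ≤ m) :
    (igfchEqs p).cost S ≤
      (u + v + d + 1) * (u + v + d + 1) * ((m + 1) * (1 + 1) +
        (2 * ((u + v + d + 1) * ((u + v + d + 1) * 2 + 1) + 1) + 1) + 1) +
      ((m + 1) * (1 + 1) + (2 * ((u + v + d + 1) * ((u + v + d + 1) * 2 + 1) + 1) + 1 +
      ((u + v + d + 1) * (u + v + d + 1) * ((m + 1) * (1 + 1) +
        (2 * ((u + v + d + 1) * ((u + v + d + 1) * 2 + 1) + 1) + 1) + 1) +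
      (u + v + d + 1) * (u + v + d + 1) * ((m + 1) * (1 + 1) +
        (2 * ((u + v + d + 1) * ((u + v + d + 1) * 2 + 1) + 1) + 1) + 1)))) := by
  simp only [Problem.r, Problem.s] at hp
  have hfilter : ∀ P : Fin (u + v + d + 1) × Fin (u + v + d + 1) → Bool,
      ((pairs (u + v + d + 1)).filter P).length ≤ (u + v + d + 1) * (u + v + d + 1) := fun P =>
    (List.length_filter_le _ _).trans (length_pairs _).le
  simp only [igfchEqs, bind_eq, pure_eq, cost_bind, cost_ret, cost_lit, zero_add, add_zero]
  refine add_le_add (cost_mapL_le S (length_pairs _).le fun ab => ?_) (add_le_add ?_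
    (le_of_eq_of_le (add_assoc _ _ _).symm (add_le_add (Nat.add_le_add_right ?_ 1)
      (add_le_add ?_ ?_))))
  · simp only [cost_bind, cost_ret, cost_lit, zero_add]
    refine add_le_add (cost_build_le S (by omega) fun i => ?_)
      (Nat.add_le_add_right (cost_build_le S le_rfl fun i => cost_unitMat_le S _ _ _) 1)
    cases i using Fin.addCases with
    | left i => simp
    | right i =>
      cases i using Fin.cases with
      | zero =>
        simp only [Fin.addCases_right, Fin.cases_zero]
        split <;> simp
      | succ i => simp
  · refine cost_build_le S (by omega) fun i => ?_
    cases i using Fin.addCases <;> simp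
  · exact cost_build_le S le_rfl fun i => cost_zeroMat_le S _
  · exact cost_vanishEqs_le S _ _ _ _ (by omega) (hfilter _)
  · exact cost_vanishEqs_le S _ _ _ _ (by omega) (hfilter _)

/-- Three families indexed by pairs: the polynomial identity and the vanishing conditions on the two
matrices. The extra equation is the normalisation of η. -/
theorem length_igfchEqs_le (p : Problem ℝ (u + v + d)) :
    ((igfchEqs p).val S).length ≤ 3 * ((u + v + d + 1) * (u + v + d + 1)) + 1 := by
  have hfilter : ∀ P : Fin (u + v + d + 1) × Fin (u + v + d + 1) → Bool,
      ((pairs (u + v + d + 1)).filter P).length ≤ (u + v + d + 1) * (u + v + d + 1) := fun P =>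
    (List.length_filter_le _ _).trans (length_pairs _).le
  have h₁ := hfilter fun ab => isZ u v d ab.1 || isZ u v d ab.2
  have h₂ := hfilter fun ab => isY u v d ab.1 || isY u v d ab.2
  simp only [igfchEqs, bind_eq, pure_eq, val_bind, val_ret, val_mapL, List.length_cons,
    List.length_append, List.length_map, length_vanishEqs, length_pairs]
  omega

theorem cost_igfchResult_le {m : ℕ} {p : Problem ℝ (u + v + d)} (hp : p.r + p.s ≤ m)
    (w : Fin ((p.r₁ + p.r₂) + (p.s₁ + p.s₂ + 1)) → ℝ) (M : Mat ℝ (u + v + d)) :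
    (igfchResult p w M).cost S ≤
      (u + v + d + 1) * ((u + v + d + 1) * (m * (1 + 2) + 1 + (m * (1 + 2) + 1 + 3) + 1) + 1) +
      (m * (0 + 2) + 1 + 2) := by
  simp only [Problem.r, Problem.s] at hp
  refine (cost_bind S _ _).le.trans (add_le_add (cost_build_le S le_rfl fun a =>
    cost_build_le S le_rfl fun b => ?_) ?_)
  · simp only [bind_eq, cost_bind, cost_add]
    refine add_le_add (cost_sum_le S (by omega) fun i => by simp)
      (add_le_add (cost_sum_le S (by omega) fun i => by simp) ?_)
    split <;> simp
  · simp only [bind_eq, cost_bind, cost_add, cost_isPos, cost_ret, zero_add]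
    exact Nat.add_le_add_right (cost_sum_le S (by omega) fun i => by simp) 2

theorem cost_igfch_le {m l T : ℕ} {p : Problem ℝ (u + v + d)} (hp : p.r + p.s ≤ m)
    (hT : ∀ I : SDP ℝ, I.size ≤ l → S.time I ≤ T)
    (hl : m + 1 + 2 * (u + v + d + 1) ^ 2 +
      (3 * ((u + v + d + 1) * (u + v + d + 1)) + 1) ≤ l) :
    (igfch p).cost S ≤ (igfchEqs p).cost S +
      ((u + v + d + 1) * ((u + v + d + 1) * (m * (1 + 2) + 1 + (m * (1 + 2) + 1 + 3) + 1) + 1) +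
        (m * (0 + 2) + 1 + 2) + T) := by
  simp only [igfch, bind_eq, cost_bind, cost_sdp]
  refine Nat.add_le_add_left (add_le_add ?_ (hT _ (le_trans ?_ hl))) _
  · split
    · simp
    · exact cost_igfchResult_le S hp _ _
  · have := length_igfchEqs_le S p
    simp only [Problem.r, Problem.s] at hp
    simp only [SDP.size, Finset.sum_const, Finset.card_univ, Fintype.card_fin, smul_eq_mul]
    omega

theorem cost_h₁Mat_le {l : ℕ} (L : List (Square ℝ (u + v + d))) (c : ℝ) (hL : L.length ≤ l) :
    (h₁Mat L c).cost S ≤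
      (u + v + d + 1) * ((u + v + d + 1) * (l * (4 + 1) + 1 + 1) + 1) + 2 := by
  simp only [h₁Mat, cost_lit]
  refine Nat.add_le_add_right (cost_build_le S le_rfl fun a =>
    cost_build_le S le_rfl fun b => ?_) 2
  rw [cost_lit]
  refine Nat.add_le_add_right (cost_loop_le S hL (fun q acc => ?_) _) 1
  split
  · simp
  · simp only [cost_mul]
    split <;> simp

/-! ### Counting the occurring variables -/

/-- A bound for the number of steps of one call of `igfqcCall` without the elimination of
variables, for `n` variables, at most `m` inequalities and solver calls of at most `T` steps. -/
def callBound (n m T : ℕ) : ℕ :=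
  2 * T + 200 * ((n + 1) ^ 4 + (n + 1) ^ 2 * m)

/-- A bound for the number of steps for the elimination of one variable. -/
def eliminationBound (n m : ℕ) : ℕ :=
  100 * ((n + 1) ^ 4 + (n + 1) ^ 2 * m)

/-- The monomials `N ^ i` and `N ^ i * m` are dominated by those of highest degree. -/
theorem monomial_bounds (N m : ℕ) (hN : 1 ≤ N) :
    1 ≤ N ^ 4 ∧ N ≤ N ^ 4 ∧ N ^ 2 ≤ N ^ 4 ∧ N ^ 3 ≤ N ^ 4 ∧ m ≤ N ^ 2 * m ∧ N * m ≤ N ^ 2 * m := by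
  refine ⟨Nat.one_le_pow _ _ hN, Nat.le_self_pow (by norm_num) _,
    Nat.pow_le_pow_right hN (by norm_num), Nat.pow_le_pow_right hN (by norm_num),
    Nat.le_mul_of_pos_left _ (Nat.pow_pos hN), ?_⟩
  exact Nat.mul_le_mul_right _ (Nat.le_self_pow (by norm_num) _)

section Shape

variable {n : ℕ}

open Classical in
/-- The variables that occur in a problem. -/
noncomputable def Problem.vars (p : Problem ℝ n) : Finset (Fin n) :=
  Finset.univ.filter fun k => ¬ p.Absent k.castSucc

theorem Problem.mem_vars {p : Problem ℝ n} {k : Fin n} :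
    k ∈ p.vars ↔ ¬ p.Absent k.castSucc := by
  simp [Problem.vars]

/-- Eliminating the variables of the squares of `M` removes them from the problem, if `M` is
minus a combination of the polynomials of the problem. -/
theorem card_vars_eliminate {p : Problem ℝ n} {δ : Fin (p.r₁ + p.r₂) → ℝ} {M : Mat ℝ n}
    (hM : M.IsSymm) (hδ : ∀ a b, ∑ i, p.f i a b * δ i + M a b = 0)
    {L : List (Square ℝ n)}
    (hL : L = ((completeSquares ((List.finRange n).map Fin.castSucc) M).val S).1) :
    ((eliminate L p).val S).vars.card + L.length ≤ p.vars.card := by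
  -- By `hδ`, row `k` of `M` is a combination of zero rows.
  have habs : ∀ k, p.Absent k → ∀ q ∈ L, q.c k = 0 := by
    intro k hk
    rw [hL]
    refine coeff_completeSquares_eq_zero S hM fun b => ?_
    have := hδ k b
    simpa [hk.1 _ b] using this
  have hpair : L.Pairwise fun q q' => q'.c q.idx = 0 := hL ▸ pairwise_completeSquares S hM
  have hsub : (L.map Square.idx).Sublist ((List.finRange n).map Fin.castSucc) :=
    hL ▸ idx_completeSquares_sublist S _ M
  have hone : ∀ q ∈ L, q.c q.idx = 1 := by
    rw [hL]
    exact coeff_completeSquares_idx S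
  obtain ⟨l, hl, hmap⟩ := List.sublist_map_iff.1 hsub
  have hnodup : l.Nodup := hl.nodup (List.nodup_finRange n)
  have hlen : L.length = l.toFinset.card := by
    rw [List.toFinset_card_of_nodup hnodup, ← List.length_map (f := Square.idx), hmap,
      List.length_map]
  have hmem : ∀ k ∈ l, ∃ q ∈ L, q.idx = k.castSucc := fun k hk =>
    List.mem_map.1 (hmap ▸ List.mem_map_of_mem hk)
  -- The surviving variables and the pivots are disjoint sets of variables of `p`. A pivot occurs in
  -- `p`, since otherwise its coefficient 1 would be 0 by `habs`.
  rw [hlen, ← Finset.card_union_of_disjoint]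
  · refine Finset.card_le_card (Finset.union_subset (fun k hk => ?_) fun k hk => ?_)
    · rw [Problem.mem_vars] at hk ⊢
      exact fun h => hk (absent_eliminate S h (habs _ h))
    · rw [Problem.mem_vars]
      intro h
      obtain ⟨q, hq, hqk⟩ := hmem k (List.mem_toFinset.1 hk)
      have h₁ := hone q hq
      rw [hqk, habs _ h q hq] at h₁
      exact zero_ne_one h₁
  · rw [Finset.disjoint_left]
    intro k hk hk'
    obtain ⟨q, hq, hqk⟩ := hmem k (List.mem_toFinset.1 hk')
    exact Problem.mem_vars.1 hk (hqk ▸ absent_eliminate_idx S p hpair q hq)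

/-- With no squares and no positive constant, all diagonal entries of `M` would be nonpositive,
against trace 1. -/
theorem completeSquares_ne_nil {M : Mat ℝ n} (htr : ∑ i, M i i = 1)
    (hc : ¬ 0 < ((completeSquares ((List.finRange n).map Fin.castSucc) M).val S).2
      (Fin.last _) (Fin.last _)) :
    ((completeSquares ((List.finRange n).map Fin.castSucc) M).val S).1 ≠ [] := by
  intro h
  obtain ⟨h₁, h₂⟩ := completeSquares_eq_nil S h
  rw [h₁] at hc
  have h₃ : ∀ i, M i i ≤ 0 := by
    intro i
    cases i using Fin.lastCases with
    | last => exact not_lt.1 hc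
    | cast i => exact h₂ _ (List.mem_map_of_mem (List.mem_finRange i))
  have := Finset.sum_nonpos fun i (_ : i ∈ Finset.univ) => h₃ i
  linarith

end Shape

/-! ### Analysis of a single call -/

/-- The matrix of the polynomial `f` of a recursive call. -/
def recursionPoly {V : Type} (p : Problem V (u + v + d)) (δ : Fin (p.r₁ + p.r₂) → V)
    (H : Mat V (u + v + d)) : Prog V (Mat V (u + v + d)) :=
  build (u + v + d + 1) fun a => build (u + v + d + 1) fun b =>
    (sum p.r₁ fun i =>
      mul (δ (Fin.castAdd p.r₂ i)) (p.f (Fin.castAdd p.r₂ i) a b) ret).bind fun x =>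
    add x (H a b) ret

/-- The problem of a recursive call, for the squares `L` and the constant `c`. -/
def recursionProblem {V : Type} {n : ℕ} (p : Problem V n) (L : List (Square V n)) (c : V) :
    Prog V (Problem V n) :=
  isPos c fun t => if t then falseProblem else eliminate L p

/-- The part of `igfqcCall` that prepares the recursive call. -/
def prepareRecursion {V : Type} (p : Problem V (u + v + d)) (δ : Fin (p.r₁ + p.r₂) → V)
    (M : Mat V (u + v + d)) :
    Prog V (Formula V (u + v + d) ⊕ (Mat V (u + v + d) × Problem V (u + v + d))) :=
  (completeSquares ((List.finRange (u + v + d)).map Fin.castSucc) M).bind fun sq =>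
  (h₁Mat sq.1 (sq.2 (Fin.last _) (Fin.last _))).bind fun H =>
  (recursionPoly p δ H).bind fun f =>
  (recursionProblem p sq.1 (sq.2 (Fin.last _) (Fin.last _))).bind fun p₁ =>
  ret (Sum.inr (f, p₁))

/-- Both outcomes of the test on c return the same `f`, so the test can be moved into
`recursionProblem` and the pieces bounded separately. -/
theorem igfqcCall_eq {V : Type} (p : Problem V (u + v + d)) : igfqcCall p =
    (varSubset p).bind fun t =>
      if t then (phiFormula p).bind fun A => ret (Sum.inl A)
      else (checkNSOSC p).bind fun o =>
        match o with
        | none => (igfch p).bind fun A => ret (Sum.inl A)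
        | some w => prepareRecursion p w.1 w.2 := by
  have h : ∀ (c : V) (L : List (Square V (u + v + d))) (f : Mat V (u + v + d)),
      ((isPos c ret).bind fun t₁ : Bool =>
        if t₁ then falseProblem.bind fun p₁ => ret (Sum.inr (f, p₁))
        else (eliminate L p).bind fun p₁ => ret (Sum.inr (f, p₁))) =
      ((recursionProblem p L c).bind fun p₁ =>
        (ret (Sum.inr (f, p₁)) : Prog V (Formula V (u + v + d) ⊕ _))) := by
    intro c L f
    simp only [recursionProblem, Prog.bind]
    congr 1
    funext t
    cases t <;> rfl
  refine congrArg _ (funext fun t => ?_)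
  cases t
  · refine congrArg (Prog.bind (checkNSOSC p)) (funext fun o => ?_)
    rcases o with _ | ⟨δ, M⟩
    · rfl
    · simp only [prepareRecursion, ← h]
      rfl
  · rfl

theorem cost_recursionPoly_le {m : ℕ} {p : Problem ℝ (u + v + d)} (hp : p.r + p.s ≤ m)
    (δ : Fin (p.r₁ + p.r₂) → ℝ) (H : Mat ℝ (u + v + d)) :
    (recursionPoly p δ H).cost S ≤
      (u + v + d + 1) * ((u + v + d + 1) * (m * (1 + 2) + 1 + 1 + 1) + 1) := by
  simp only [Problem.r, Problem.s] at hp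
  refine cost_build_le S le_rfl fun a => cost_build_le S le_rfl fun b => ?_
  rw [cost_bind]
  have h := cost_sum_le S (show p.r₁ ≤ m by omega) (c := 1)
    (F := fun i => mul (δ (Fin.castAdd p.r₂ i)) (p.f (Fin.castAdd p.r₂ i) a b) ret) (by simp)
  exact (Nat.add_le_add_right h _).trans (by simp)

theorem val_prepareRecursion (p : Problem ℝ (u + v + d)) (δ : Fin (p.r₁ + p.r₂) → ℝ)
    (M : Mat ℝ (u + v + d)) : ∃ f, (prepareRecursion p δ M).val S = Sum.inr (f,
      (recursionProblem p
        ((completeSquares ((List.finRange (u + v + d)).map Fin.castSucc) M).val S).1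
        (((completeSquares ((List.finRange (u + v + d)).map Fin.castSucc) M).val S).2
          (Fin.last _) (Fin.last _))).val S) := by
  simp only [prepareRecursion, val_bind, val_ret]
  exact ⟨_, rfl⟩

/-- The cost of `recursionProblem` is kept apart because it grows with the number of squares and is
amortised later. -/
theorem cost_prepareRecursion_le {m : ℕ} {p : Problem ℝ (u + v + d)} (hp : p.r + p.s ≤ m)
    (δ : Fin (p.r₁ + p.r₂) → ℝ) (M : Mat ℝ (u + v + d)) {L : List (Square ℝ (u + v + d))} {c : ℝ}
    (hL : L = ((completeSquares ((List.finRange (u + v + d)).map Fin.castSucc) M).val S).1)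
    (hc : c = ((completeSquares ((List.finRange (u + v + d)).map Fin.castSucc) M).val S).2
      (Fin.last _) (Fin.last _)) :
    (prepareRecursion p δ M).cost S ≤ 50 * ((u + v + d + 1) ^ 4 + (u + v + d + 1) ^ 2 * m) +
      (recursionProblem p L c).cost S := by
  have hlen : L.length ≤ u + v + d := by
    have := (idx_completeSquares_sublist S ((List.finRange (u + v + d)).map Fin.castSucc)
      M).length_le
    rw [← hL] at this
    simpa using this
  have hcs := cost_completeSquares_le S ((List.finRange (u + v + d)).map Fin.castSucc) M
  have hh := cost_h₁Mat_le S L c hlen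
  have hf := fun H => cost_recursionPoly_le S hp δ H
  simp only [prepareRecursion, cost_bind, cost_ret, add_zero]
  subst hL hc
  refine (add_le_add hcs (add_le_add hh (Nat.add_le_add_right (hf _) _))).trans ?_
  simp only [List.length_map, List.length_finRange]
  generalize (recursionProblem p _ _).cost S = e
  clear * -
  generalize u + v + d = n
  -- Once expanded, the monomials in `n` and `m` are atoms, and the claim is a linear consequence of
  -- these bounds.
  obtain ⟨h0, h1, h2, h3, h4, h5⟩ := monomial_bounds (n + 1) m (by omega)
  ring_nf at *
  omega

/-- The problem of the recursive call has bounded size, and at least one variable less. -/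
theorem recursionProblem_spec {m : ℕ} (hm : 2 ≤ m) {p : Problem ℝ (u + v + d)}
    (hp : p.r + p.s ≤ m) (hne : 1 ≤ p.vars.card) {δ : Fin (p.r₁ + p.r₂) → ℝ}
    {M : Mat ℝ (u + v + d)} (hM : M.IsSymm) (htr : ∑ i, M i i = 1)
    (hδ : ∀ a b, ∑ i, p.f i a b * δ i + M a b = 0) {L : List (Square ℝ (u + v + d))} {c : ℝ}
    (hL : L = ((completeSquares ((List.finRange (u + v + d)).map Fin.castSucc) M).val S).1)
    (hc : c = ((completeSquares ((List.finRange (u + v + d)).map Fin.castSucc) M).val S).2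
      (Fin.last _) (Fin.last _)) :
    ∃ k, ((recursionProblem p L c).val S).r + ((recursionProblem p L c).val S).s ≤ m ∧ 1 ≤ k ∧
      ((recursionProblem p L c).val S).vars.card + k ≤ p.vars.card ∧
      (recursionProblem p L c).cost S ≤ 4 * (u + v + d + 1) ^ 4 +
        k * eliminationBound (u + v + d) m := by
  generalize u + v + d = n at *
  obtain ⟨h0, h1, h2, h3, h4, h5⟩ := monomial_bounds (n + 1) m (by omega)
  -- For c > 0 the next problem has two inequalities, whence `2 ≤ m`, and no variables, so k = 1
  -- suffices. Otherwise k is the number of squares.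
  by_cases h : 0 < c
  · simp only [recursionProblem, val_isPos, cost_isPos, h, decide_true, if_true,
      size_falseProblem]
    refine ⟨1, hm, le_rfl, ?_, ?_⟩
    · have : ((falseProblem : Prog ℝ (Problem ℝ n)).val S).vars = ∅ := by
        rw [Finset.eq_empty_iff_forall_notMem]
        exact fun k hk => Problem.mem_vars.1 hk (absent_falseProblem S _)
      rw [this]
      simpa using hne
    · have := cost_falseProblem_le S (n := n)
      have : (n + 1) * ((n + 1) * 2 + 1) + 1 ≤ 4 * (n + 1) ^ 4 := by
        ring_nf at *
        omega
      omega
  · simp only [recursionProblem, val_isPos, cost_isPos, h, decide_false, Bool.false_eq_true,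
      if_false]
    refine ⟨L.length, (size_eliminate S L p).le.trans hp, ?_,
      card_vars_eliminate S hM hδ hL, ?_⟩
    · have := completeSquares_ne_nil S htr (hc ▸ h)
      rw [← hL] at this
      exact List.length_pos_iff.2 this
    · refine (Nat.add_le_add_right ((cost_eliminate_le S L hp).trans
        (Nat.mul_le_mul_left _ ?_)) 1).trans (add_comm _ _ |>.le.trans
          (Nat.add_le_add_right (by omega) _))
      rw [eliminationBound]
      ring_nf at *
      omega

/-- What one call of the algorithm achieves, and in how many steps: it either returns a result, or
leaves a problem of bounded size from which at least one variable has vanished. -/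
theorem igfqcCall_spec {m l T : ℕ} (hm : 2 ≤ m) {p : Problem ℝ (u + v + d)}
    (hp : p.r + p.s ≤ m) (hT : ∀ I : SDP ℝ, I.size ≤ l → S.time I ≤ T)
    (hl : m + 5 * (u + v + d + 1) ^ 2 + 2 ≤ l) :
    (∃ I, (igfqcCall p).val S = Sum.inl I ∧
      (igfqcCall p).cost S ≤ callBound (u + v + d) m T) ∨
    ∃ f p₁ k, (igfqcCall p).val S = Sum.inr (f, p₁) ∧ p₁.r + p₁.s ≤ m ∧ 1 ≤ k ∧
      p₁.vars.card + k ≤ p.vars.card ∧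
      (igfqcCall p).cost S ≤ callBound (u + v + d) m T + k * eliminationBound (u + v + d) m := by
  have hvar := cost_varSubset_le S hp
  obtain ⟨h0, h1, h2, h3, h4, h5⟩ := monomial_bounds (u + v + d + 1) m (by omega)
  rw [igfqcCall_eq, val_bind, cost_bind]
  by_cases ht : (varSubset p).val S = true
  · left
    have hphi := cost_phiFormula_le S hp
    simp only [ht, if_true, val_bind, val_ret, cost_bind, cost_ret, add_zero]
    refine ⟨_, rfl, (add_le_add hvar hphi).trans ?_⟩
    rw [callBound]
    clear * - h0 h1 h2 h3 h4 h5
    generalize u + v + d = n at *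
    ring_nf at *
    omega
  -- A problem without variables would have passed the first test.
  have hne : 1 ≤ p.vars.card := by
    rw [Finset.one_le_card, Finset.nonempty_iff_ne_empty]
    intro h
    refine ht (val_varSubset_of_absent S fun k => ?_)
    by_contra hk
    exact absurd (Problem.mem_vars.2 hk) (by simp [h])
  have hnsos := cost_nsosEqs_le S hp
  have hchk := (cost_checkNSOSC_le S hp hT (by nlinarith)).trans
    (Nat.add_le_add_right hnsos T)
  simp only [ht, Bool.false_eq_true, if_false, val_bind, cost_bind]
  rcases hsol : (checkNSOSC p).val S with _ | ⟨δ, M⟩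
  · left
    have hig := (cost_igfch_le S hp hT (by nlinarith)).trans
      (Nat.add_le_add_right (cost_igfchEqs_le S hp) _)
    simp only [val_bind, val_ret, cost_bind, cost_ret, add_zero]
    refine ⟨_, rfl, (add_le_add hvar (add_le_add hchk hig)).trans ?_⟩
    rw [callBound]
    clear * - h0 h1 h2 h3 h4 h5
    generalize u + v + d = n at *
    ring_nf at *
    omega
  right
  obtain ⟨hM, htr, hδ⟩ := val_checkNSOSC S hsol
  have hsymm : M.IsSymm := by
    have := hM.isHermitian
    rwa [Matrix.IsHermitian, Matrix.conjTranspose_eq_transpose_of_trivial] at this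
  obtain ⟨k, hk₁, hk₂, hk₃, hk₄⟩ := recursionProblem_spec S hm hp hne hsymm htr hδ rfl rfl
  have hprep := cost_prepareRecursion_le S hp δ M rfl rfl
  obtain ⟨f, hf⟩ := val_prepareRecursion S p δ M
  refine ⟨f, _, k, hf, hk₁, hk₂, hk₃, ?_⟩
  refine (add_le_add hvar (add_le_add hchk (hprep.trans (Nat.add_le_add_left hk₄ _)))).trans ?_
  rw [callBound]
  generalize k * eliminationBound (u + v + d) m = k'
  clear * - h0 h1 h2 h3 h4 h5
  generalize u + v + d = n at *
  ring_nf at *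
  omega

/-! ### Induction on the number of variables -/

/-- There are at most `K + 1` calls, each paying `callBound` and at most one step for recursing,
while each of at most `K` variables pays once for its elimination. The induction is strong because
one call may remove several variables. -/
theorem exists_IGFQC {m l T : ℕ} (hm : 2 ≤ m)
    (hT : ∀ I : SDP ℝ, I.size ≤ l → S.time I ≤ T) (hl : m + 5 * (u + v + d + 1) ^ 2 + 2 ≤ l)
    (K : ℕ) (p : Problem ℝ (u + v + d)) (hp : p.r + p.s ≤ m) (hK : p.vars.card ≤ K) :
    ∃ I N t, IGFQC S p I N t ∧ N ≤ K ∧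
      t ≤ (K + 1) * (callBound (u + v + d) m T + 1) + K * eliminationBound (u + v + d) m := by
  induction K using Nat.strong_induction_on generalizing p with
  | _ K ih =>
    rcases igfqcCall_spec S hm hp hT hl with ⟨I, hI, hcost⟩ | ⟨f, p₁, k, hI, hp₁, hk, hvars, hcost⟩
    · refine ⟨I, 0, _, IGFQC.base p I ((igfqcCall p).cost S) (by rw [run_eq, hI]),
        Nat.zero_le _, ?_⟩
      nlinarith
    · obtain ⟨K', rfl⟩ := Nat.exists_eq_add_of_le (show k ≤ K by omega)
      obtain ⟨I, N, t, h, hN, ht⟩ := ih K' (by omega) p₁ hp₁ (by omega)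
      refine ⟨_, _, _, IGFQC.recurse p p₁ f I N ((igfqcCall p).cost S) t
        (by rw [run_eq, hI]) h, by omega, ?_⟩
      generalize callBound (u + v + d) m T = B at *
      generalize eliminationBound (u + v + d) m = E at *
      have : B + 1 ≤ k * (B + 1) := Nat.le_mul_of_pos_left _ hk
      calc (igfqcCall p).cost S + t + 1
          ≤ B + k * E + ((K' + 1) * (B + 1) + K' * E) + 1 := by omega
        _ ≤ k * (B + 1) + k * E + ((K' + 1) * (B + 1) + K' * E) := by omega
        _ = (k + K' + 1) * (B + 1) + (k + K') * E := by ring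

/-! ### Absorbing the overhead into the solver time -/

/-- A solver reads its input, so its time on the problems of size `k` is quadratic at least. -/
theorem sq_le_four_mul_time (k : ℕ) : ∃ I : SDP ℝ, I.size = k ∧ k ^ 2 ≤ 4 * S.time I := by
  -- Splitting the size evenly between unknowns and equations makes the number of data entries about
  -- k²/4.
  refine ⟨⟨k / 2, 0, Fin.elim0, List.replicate (k - k / 2) ⟨fun _ => 0, fun b => b.elim0, 0⟩⟩,
    ?_, ?_⟩
  · simp [SDP.size]
    omega
  · refine le_trans ?_ (Nat.mul_le_mul_left 4 (S.reads _))
    simp only [SDP.numEntries, List.length_replicate, Finset.univ_eq_empty, Finset.sum_empty,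
      add_zero]
    obtain ⟨t, rfl | rfl⟩ := Nat.even_or_odd' k
    · rw [show 2 * t - 2 * t / 2 = t by omega, show 2 * t / 2 = t by omega]
      nlinarith
    · rw [show 2 * t + 1 - (2 * t + 1) / 2 = t + 1 by omega, show (2 * t + 1) / 2 = t by omega]
      nlinarith

/-- The polynomial overhead is linear in the lower bound for the time of the solver. -/
theorem overhead_le {n r k : ℕ} (hn : 1 ≤ n) (hk : k = r + n ^ 2) :
    (n + 1) ^ 4 + (n + 1) ^ 2 * (r + 2) ≤ 28 * k ^ 2 := by
  have h₁ : (n + 1) ^ 2 ≤ 4 * n ^ 2 := by nlinarith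
  have h₂ : 1 ≤ n ^ 2 := Nat.one_le_pow _ _ hn
  calc (n + 1) ^ 4 + (n + 1) ^ 2 * (r + 2)
      = (n + 1) ^ 2 * ((n + 1) ^ 2 + r + 2) := by ring
    _ ≤ (4 * n ^ 2) * (4 * n ^ 2 + r + 2 * n ^ 2) := by gcongr; omega
    _ ≤ 28 * k ^ 2 := by
      subst hk
      nlinarith [Nat.zero_le (r * n ^ 2), Nat.zero_le (r ^ 2), Nat.zero_le ((n ^ 2) ^ 2)]

end CQInterp

theorem mainTheorem9 (D : ℝ) :
    ∃ C : ℝ, ∀ (g : ℕ → ℝ), Monotone g → (∀ k, g (2 * k) ≤ D * g k) →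
      ∀ S : CQInterp.SDPSolver, (∀ I : CQInterp.SDP ℝ, (S.time I : ℝ) ≤ g I.size) →
        ∀ (u v d : ℕ) (p : CQInterp.Problem ℝ (u + v + d)), 1 ≤ u + v + d → p.Valid →
          ∃ (I : CQInterp.Formula ℝ (u + v + d)) (N t : ℕ),
            CQInterp.IGFQC S p I N t ∧ N ≤ u + v + d ∧
              (t : ℝ) ≤ C * ((u + v + d : ℕ) : ℝ) * g (p.r + p.s + (u + v + d) ^ 2) := by
  refine ⟨60000 + 4 * D ^ 5, fun g hg hD S hS u v d p hn _ => ?_⟩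
  have hgk : ∀ k : ℕ, (k : ℝ) ^ 2 ≤ 4 * g k := by
    intro k
    obtain ⟨I, rfl, hI⟩ := CQInterp.sq_le_four_mul_time S k
    have h₁ : ((I.size : ℕ) : ℝ) ^ 2 ≤ 4 * (S.time I : ℝ) := by exact_mod_cast hI
    linarith [hS I]
  have hg0 : ∀ k, 0 ≤ g k := fun k => by nlinarith [hgk k, sq_nonneg (k : ℝ)]
  set k := p.r + p.s + (u + v + d) ^ 2 with hk
  have hk1 : 1 ≤ k := by
    have := Nat.one_le_pow 2 _ hn
    omega
  have hk1' : (1 : ℝ) ≤ (k : ℝ) ^ 2 := by exact_mod_cast Nat.one_le_pow 2 _ hk1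
  have hgpos : 0 < g k := by linarith [hgk k]
  -- A negative `D` would make g(2k) negative, as g(k) > 0.
  have hD0 : 0 ≤ D := by
    by_contra h
    nlinarith [hD k, hg0 (2 * k)]
  have hpow : ∀ j : ℕ, g (2 ^ j * k) ≤ D ^ j * g k := by
    intro j
    induction j with
    | zero => simp
    | succ j ih =>
      calc g (2 ^ (j + 1) * k) = g (2 * (2 ^ j * k)) := by congr 1; ring
        _ ≤ D * g (2 ^ j * k) := hD _
        _ ≤ D * (D ^ j * g k) := mul_le_mul_of_nonneg_left ih hD0
        _ = D ^ (j + 1) * g k := by ring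
  -- The larger SDP has size at most r + s + 4 + 5(n + 1)² ≤ 24k, and 32 is the next power of two.
  have h32 : g (32 * k) ≤ D ^ 5 * g k := by simpa using hpow 5
  have hT : ∀ I : CQInterp.SDP ℝ, I.size ≤ 32 * k → S.time I ≤ ⌊g (32 * k)⌋₊ := fun I hI =>
    Nat.le_floor ((hS I).trans (hg hI))
  have hvars : p.vars.card ≤ u + v + d := by
    simpa using Finset.card_le_univ p.vars
  -- The summand 2 leaves room for the two inequalities 0 > 0 of the false problem.
  obtain ⟨I, N, t, h, hN, ht⟩ := CQInterp.exists_IGFQC S (m := p.r + p.s + 2) (by omega) hT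
    (by nlinarith) (u + v + d) p (by omega) hvars
  refine ⟨I, N, t, h, hN, ?_⟩
  have hover := CQInterp.overhead_le (r := p.r + p.s) hn hk
  rw [CQInterp.callBound, CQInterp.eliminationBound] at ht
  clear_value k
  clear * - ht hover hn hgk hg0 hgpos h32 hk1'
  generalize u + v + d = n at *
  generalize p.r + p.s + 2 = m at *
  have hover' : (((n + 1) ^ 4 + (n + 1) ^ 2 * m : ℕ) : ℝ) ≤ 112 * g k := by
    have : (((n + 1) ^ 4 + (n + 1) ^ 2 * m : ℕ) : ℝ) ≤ 28 * (k : ℝ) ^ 2 := by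
      exact_mod_cast hover
    linarith [hgk k]
  generalize (n + 1) ^ 4 + (n + 1) ^ 2 * m = W at *
  have hfloor : (⌊g (32 * k)⌋₊ : ℝ) ≤ D ^ 5 * g k := (Nat.floor_le (hg0 _)).trans h32
  generalize ⌊g (32 * k)⌋₊ = T at *
  have hn' : (1 : ℝ) ≤ n := by exact_mod_cast hn
  have ht' : (t : ℝ) ≤ (n + 1) * (2 * T + 200 * W + 1) + n * (100 * W) := by exact_mod_cast ht
  -- Uses n + 1 ≤ 2n and 1 ≤ k² ≤ 4g(k). The resulting constant is 56008 + 4D⁵, rounded up.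
  calc (t : ℝ) ≤ (n + 1) * (2 * T + 200 * W + 1) + n * (100 * W) := ht'
    _ ≤ (n + n) * (2 * (D ^ 5 * g k) + 200 * (112 * g k) + 4 * g k) + n * (100 * (112 * g k)) := by
      gcongr
      linarith [hgk k]
    _ ≤ (60000 + 4 * D ^ 5) * n * g k := by
      have : 0 ≤ n * g k := mul_nonneg (by linarith) hgpos.le
      nlinarith
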